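/- Let $(\epsilon_k)_{k\ge 1}$ be a sequence of positive real numbers such that, for some real $r<1$, $\epsilon_{k+1}\le r\,\epsilon_k$ for all $k\ge 1$. For $\epsilon>0$ and $f$ in $L^p(\mathbb{R})$ or in $L^p(\mathbb{T})$, $\mathbb{T}=\mathbb{R}/2\pi\mathbb{Z}$ (complex-valued functions, Lebesgue measure), put $$D_\epsilon f(x)=\frac1{2\epsilon}\int_{-\epsilon}^{\epsilon} f(x-y)\,dy .$$ Then for every $1<p<\infty$ and every $f$ in $L^p(\mathbb{R})$, and likewise for every $f$ in $L^p(\mathbb{T})$, all $D_{\epsilon_k}f$ belong to $L^p$ and the series $\sum_{k=1}^\infty \left(D_{\epsilon_{k+1}}f-D_{\epsilon_k}f\right)$ converges unconditionally in $L^p$; that is, for every permutation $\pi$ of $\{1,2,3,\dots\}$ the series $\sum_{k=1}^\infty \left(D_{\epsilon_{\pi(k)+1}}f-D_{\epsilon_{\pi(k)}}f\right)$ converges in the $L^p$ norm. -/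

import Mathlib

open MeasureTheory Filter Topology
open scoped ENNReal Real

/-- Unconditional convergence of a series in a normed space: every rearrangement of the
series converges in norm. (Terms are indexed by `0, 1, 2, …`.) -/
def UnconditionallyConvergent {E : Type*} [NormedAddCommGroup E] (u : ℕ → E) : Prop :=
  ∀ σ : Equiv.Perm ℕ, ∃ s : E,
    Tendsto (fun n : ℕ => ∑ k ∈ Finset.range n, u (σ k)) atTop (𝓝 s)

/-- The average `D_ε f (x) = (1 / 2ε) ∫_{-ε}^{ε} f (x - y) dy` of a function on the line. -/
noncomputable def lineD (ε : ℝ) (f : ℝ → ℂ) (x : ℝ) : ℂ :=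
  ((1 / (2 * ε) : ℝ) : ℂ) * ∫ y in (-ε)..ε, f (x - y)

/-- The average `D_ε f (x) = (1 / 2ε) ∫_{-ε}^{ε} f (x - y) dy` of a function on the circle
`𝕋 = ℝ / 2πℤ`, where `y` is taken modulo `2π`. -/
noncomputable def torusD (ε : ℝ) (f : AddCircle (2 * π) → ℂ) (x : AddCircle (2 * π)) : ℂ :=
  ((1 / (2 * ε) : ℝ) : ℂ) * ∫ y in (-ε)..ε, f (x - (y : AddCircle (2 * π)))

/-- The period `2π` is positive; this provides Lebesgue measure (of total mass `2π`) on `𝕋`. -/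
instance factTwoPiPos : Fact (0 < 2 * π) := ⟨Real.two_pi_pos⟩

/-! By completeness, the series converges unconditionally once its sums over finite sets `F` of late
indices are small in `L^p`, whatever the set `F`. This is proved by density. For a test function
`g`, `D_ε g - g` has `L^p` norm `O(ε)`, and `∑ ε k` converges geometrically, so late sums are small
term by term. To pass from test functions to all of `L^p` one needs a bound for the operators `f ↦ ∑
k ∈ F, (D_{ε(k+1)} f - D_{ε k} f)` that does not depend on `F` (`exists_eLpNorm_sum_lineD_sub_le`).

That uniform bound is a Calderón–Zygmund theorem. The operator is convolution with `differenceKernel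
ε F`, and lacunarity supplies both hypotheses with constants depending only on `r`. On the Fourier
side the multiplier is a sum of differences of `sinc (ω ε k)`. This quantity is near `1` at scales
well below `1/ω` and near `0` well above, with errors that sum geometrically
(`abs_sum_sinc_sub_le`), so Plancherel gives the `L²` bound. For Hörmander's condition at scale `h`,
an average of radius `e` contributes at most `2h/e` if `e ≥ h` and nothing otherwise; these again
sum geometrically (`isHormanderKernel_differenceKernel`).

The Calderón–Zygmund theorem itself rests on the rising sun lemma, which gives intervals where the
mean of `f` is exactly `l`. The resulting estimate of distribution functions integrates to `L^p`
bounds for `1 < p < 2`; evenness of the kernel gives `p > 2` by duality.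

The circle needs no separate harmonic analysis: for `ε ≤ 2π` the circle average on one period is the
line average of a lift cut off to three periods, so the tail estimate is inherited from the line. -/

section

open ContinuousLinearMap (lsmul)
open scoped Convolution NNReal FourierTransform

/-! ### Rising sun lemma and stopping intervals. -/

/-- An open subset of the line whose complement is unbounded in both directions is a countable
disjoint union of bounded open intervals with endpoints outside the set. -/
theorem IsOpen.exists_countable_iUnion_Ioo {U : Set ℝ} (hU : IsOpen U)
    (hl : ∀ x, ∃ y ≤ x, y ∉ U) (hr : ∀ x, ∃ y ≥ x, y ∉ U) :
    ∃ S : Set (ℝ × ℝ), S.Countable ∧ S.PairwiseDisjoint (fun q => Set.Ioo q.1 q.2) ∧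
      (⋃ q ∈ S, Set.Ioo q.1 q.2) = U ∧ ∀ q ∈ S, q.1 < q.2 ∧ q.1 ∉ U ∧ q.2 ∉ U := by
  set S : Set (ℝ × ℝ) := {q | q.1 < q.2 ∧ Set.Ioo q.1 q.2 ⊆ U ∧ q.1 ∉ U ∧ q.2 ∉ U} with hS
  have hdisj : S.PairwiseDisjoint (fun q => Set.Ioo q.1 q.2) := by
    rintro ⟨a, b⟩ ⟨hab, hI, ha, hb⟩ ⟨c, d⟩ ⟨hcd, hJ, hc, hd⟩ hne
    refine Set.disjoint_left.2 fun x hx hx' => hne ?_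
    simp only [Set.mem_Ioo] at *
    have h1 : a = c := by
      rcases lt_trichotomy a c with h | h | h
      · exact absurd (hI ⟨h, hx'.1.trans hx.2⟩) hc
      · exact h
      · exact absurd (hJ ⟨h, hx.1.trans hx'.2⟩) ha
    have h2 : b = d := by
      rcases lt_trichotomy b d with h | h | h
      · exact absurd (hJ ⟨hx'.1.trans hx.2, h⟩) hb
      · exact h
      · exact absurd (hI ⟨hx.1.trans hx'.2, h⟩) hd
    rw [h1, h2]
  refine ⟨S, hdisj.countable_of_isOpen (fun _ _ => isOpen_Ioo)
    (fun q hq => Set.nonempty_Ioo.2 hq.1), hdisj, ?_, fun q hq => ⟨hq.1, hq.2.2⟩⟩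
  refine Set.Subset.antisymm (Set.iUnion₂_subset fun q hq => hq.2.1) fun x hx => ?_
  -- The component of `x` ends at the nearest points of the complement on either side, which exist
  -- by `hl` and `hr`.
  set L := Uᶜ ∩ Set.Iic x
  set R := Uᶜ ∩ Set.Ici x
  have hLc : IsClosed L := hU.isClosed_compl.inter isClosed_Iic
  have hRc : IsClosed R := hU.isClosed_compl.inter isClosed_Ici
  have hLb : BddAbove L := ⟨x, fun y hy => hy.2⟩
  have hRb : BddBelow R := ⟨x, fun y hy => hy.2⟩
  have hLm : sSup L ∈ L := hLc.csSup_mem (by obtain ⟨y, h, h'⟩ := hl x; exact ⟨y, h', h⟩) hLb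
  have hRm : sInf R ∈ R := hRc.csInf_mem (by obtain ⟨y, h, h'⟩ := hr x; exact ⟨y, h', h⟩) hRb
  have h1 : sSup L < x := lt_of_le_of_ne hLm.2 fun h => hLm.1 (h ▸ hx)
  have h2 : x < sInf R := lt_of_le_of_ne hRm.2 fun h => hRm.1 (h ▸ hx)
  refine Set.mem_iUnion₂.2 ⟨(sSup L, sInf R), ⟨h1.trans h2, fun y hy => ?_, hLm.1, hRm.1⟩, h1, h2⟩
  by_contra hyU
  rcases le_total y x with h | h
  · exact absurd (le_csSup hLb ⟨hyU, h⟩) (not_le.2 hy.1)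
  · exact absurd (csInf_le hRb ⟨hyU, h⟩) (not_le.2 hy.2)

/-- Riesz's rising sun lemma: `G` takes equal values at the endpoints of a component of the set of
points in the shadow of its graph. -/
theorem rising_sun_endpoints {G : ℝ → ℝ} (hG : Continuous G) {a b : ℝ} (hab : a < b)
    (hI : ∀ x ∈ Set.Ioo a b, ∃ y > x, G x < G y) (ha : ∀ y > a, G y ≤ G a)
    (hb : ∀ y > b, G y ≤ G b) : G a = G b := by
  refine le_antisymm ?_ (ha b hab)
  have key : ∀ x ∈ Set.Ioo a b, G x ≤ G b := by
    intro x hx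
    by_contra! hlt
    -- Take the last point `z` of `[x, b]` where `G` is at least `G x`. It is in the shadow of some
    -- later `y`: if `y ≤ b`, maximality of `z` fails; if `y > b`, then `G y ≤ G b < G x`.
    set Z := Set.Icc x b ∩ {z | G x ≤ G z}
    have hZ : IsCompact Z := isCompact_Icc.inter_right (isClosed_le continuous_const hG)
    obtain ⟨z, hz, hmax⟩ := hZ.exists_isGreatest ⟨x, ⟨le_rfl, hx.2.le⟩, le_refl (G x)⟩
    have hzb : z < b := lt_of_le_of_ne hz.1.2 fun h => by
      have := hz.2; simp only [Set.mem_ofPred_eq, h] at this; linarith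
    obtain ⟨y, hyz, hy⟩ := hI z ⟨hx.1.trans_le hz.1.1, hzb⟩
    have hxy : G x ≤ G y := (show G x ≤ G z from hz.2).trans hy.le
    rcases le_or_gt y b with h | h
    · exact absurd (hmax ⟨⟨hz.1.1.trans hyz.le, h⟩, hxy⟩) (not_le.2 hyz)
    · linarith [hb y h]
  refine le_of_tendsto (hG.continuousWithinAt (s := Set.Ioi a)) ?_
  filter_upwards [Ioo_mem_nhdsGT hab] with x hx using key x hx

/-- The Calderón–Zygmund decomposition on the line, from the rising sun lemma. -/
theorem exists_calderon_zygmund_intervals {f : ℝ → ℝ} (hf : Continuous f)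
    (hfc : HasCompactSupport f) (hf0 : ∀ x, 0 ≤ f x) {l : ℝ} (hl : 0 < l) :
    ∃ S : Set (ℝ × ℝ), S.Countable ∧ S.PairwiseDisjoint (fun q => Set.Ioo q.1 q.2) ∧
      (∀ q ∈ S, q.1 < q.2 ∧ ∫ x in q.1..q.2, f x = l * (q.2 - q.1)) ∧
      ∀ x ∉ ⋃ q ∈ S, Set.Ioo q.1 q.2, f x ≤ l := by
  -- With this primitive, equal values of `G` at the ends of an interval say that `f` has mean `l`
  -- there, and a point outside the shadow has nonpositive right derivative `f x - l`.
  set G : ℝ → ℝ := fun x => ∫ t in (0 : ℝ)..x, (f t - l) with hGdef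
  have hφ : Continuous fun t => f t - l := by fun_prop
  have hii : ∀ a b, IntervalIntegrable (fun t => f t - l) volume a b :=
    fun a b => hφ.intervalIntegrable a b
  have hG : Continuous G := intervalIntegral.continuous_primitive hii 0
  have hGsub : ∀ a b, G b - G a = (∫ t in a..b, f t) - l * (b - a) := by
    intro a b
    rw [intervalIntegral.integral_interval_sub_left (hii _ _) (hii _ _),
      intervalIntegral.integral_sub (hf.intervalIntegrable _ _) (by simp)]
    simp [mul_comm]
  have hfi : Integrable f := hf.integrable_of_hasCompactSupport hfc
  set M := ∫ t, f t
  have hIle : ∀ a b, a ≤ b → ∫ t in a..b, f t ≤ M := fun a b hab => by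
    rw [intervalIntegral.integral_of_le hab]
    exact setIntegral_le_integral hfi (ae_of_all _ hf0)
  set U : Set ℝ := {x | ∃ y > x, G x < G y} with hUdef
  have hU : IsOpen U := by
    have : U = ⋃ y, (Set.Iio y ∩ {x | G x < G y}) := by
      ext x; simp [hUdef]
    rw [this]
    exact isOpen_iUnion fun y => isOpen_Iio.inter (isOpen_lt hG continuous_const)
  -- If `x` is shadowed by `y`, the mean of `f` on `[x, y]` exceeds `l`, so `y - x < M / l` and `f`
  -- is positive somewhere in between. Hence `U` is bounded, as its decomposition into bounded
  -- intervals requires.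
  have hnear : ∀ x ∈ U, ∃ t ∈ Set.Icc x (x + M / l), 0 < f t := by
    rintro x ⟨y, hxy, hlt⟩
    by_contra! h
    have h1 : l * (y - x) < ∫ t in x..y, f t := by linarith [hGsub x y]
    have h2 : y - x < M / l := by
      rw [lt_div_iff₀ hl]; linarith [hIle x y (le_of_lt hxy)]
    have h3 : ∫ t in x..y, f t = 0 := by
      rw [intervalIntegral.integral_congr (g := fun _ => (0 : ℝ))]
      · simp
      · intro t ht
        rw [Set.uIcc_of_le (le_of_lt hxy)] at ht
        exact le_antisymm (h t ⟨ht.1, by linarith [ht.2]⟩) (hf0 t)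
    have : 0 < y - x := sub_pos.2 hxy
    nlinarith
  obtain ⟨R, hR⟩ := hfc.isCompact.isBounded.subset_closedBall 0
  have hR' : ∀ t, 0 < f t → |t| ≤ R := fun t ht => by
    simpa using hR (subset_tsupport _ (Function.mem_support.2 ht.ne'))
  obtain ⟨S, hSc, hSd, hSU, hSe⟩ := hU.exists_countable_iUnion_Ioo
    (fun x => ⟨min x (-R - M / l - 1), min_le_left _ _, fun hmem => by
      obtain ⟨t, ht, h0⟩ := hnear _ hmem
      have := (abs_le.1 (hR' t h0)).1
      have := min_le_right x (-R - M / l - 1)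
      linarith [ht.2]⟩)
    (fun x => ⟨max x (R + 1), le_max_left _ _, fun hmem => by
      obtain ⟨t, ht, h0⟩ := hnear _ hmem
      have := (abs_le.1 (hR' t h0)).2
      have := le_max_right x (R + 1)
      linarith [ht.1]⟩)
  have hnot : ∀ x ∉ U, ∀ y > x, G y ≤ G x := fun x hx y hy => by
    by_contra! h
    exact hx ⟨y, hy, h⟩
  refine ⟨S, hSc, hSd, fun q hq => ⟨(hSe q hq).1, ?_⟩, fun x hx => ?_⟩
  · have := rising_sun_endpoints hG (hSe q hq).1
      (fun x hx => hSU.subset (Set.mem_iUnion₂.2 ⟨q, hq, hx⟩))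
      (hnot _ (hSe q hq).2.1) (hnot _ (hSe q hq).2.2)
    linarith [hGsub q.1 q.2]
  · rw [hSU] at hx
    have hd : HasDerivAt G (f x - l) x :=
      intervalIntegral.integral_hasDerivAt_right (hii _ _)
        (hφ.stronglyMeasurableAtFilter _ _) hφ.continuousAt
    have := hd.hasDerivWithinAt (s := Set.Ioi x)
    rw [hasDerivWithinAt_iff_tendsto_slope' (by simp)] at this
    have h0 : f x - l ≤ 0 := by
      refine le_of_tendsto this ?_
      filter_upwards [self_mem_nhdsWithin] with y hy
      rw [slope_def_field]
      exact div_nonpos_of_nonpos_of_nonneg (by linarith [hnot x hx y hy])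
        (sub_nonneg.2 (le_of_lt hy))
    linarith

/-! ### The Calderón–Zygmund distributional estimate. -/

theorem integrable_convolution_integrand_of_bounded {K g : ℝ → ℝ} (hK : Integrable K)
    (hg : AEStronglyMeasurable g) {M : ℝ} (hM : ∀ x, |g x| ≤ M) (x : ℝ) :
    Integrable fun t => K (x - t) * g t :=
  (hK.comp_sub_left x).mul_bdd hg (ae_of_all _ hM)

/-- Linearity is stated for bounded functions because the good and bad parts of a decomposition are
not continuous. -/
theorem convolution_sub_of_bounded {K f g : ℝ → ℝ} (hK : Integrable K)
    (hf : AEStronglyMeasurable f) (hg : AEStronglyMeasurable g)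
    {M N : ℝ} (hM : ∀ x, |f x| ≤ M) (hN : ∀ x, |g x| ≤ N) :
    K ⋆[lsmul ℝ ℝ] (fun x => f x - g x) = K ⋆[lsmul ℝ ℝ] f - K ⋆[lsmul ℝ ℝ] g := by
  ext x
  simp only [convolution_lsmul_swap, Pi.sub_apply, smul_eq_mul, mul_sub]
  exact integral_sub (integrable_convolution_integrand_of_bounded hK hf hM x)
    (integrable_convolution_integrand_of_bounded hK hg hN x)

theorem setLIntegral_translate_kernel_le {K : ℝ → ℝ} {B : ℝ≥0∞}
    (hH : ∀ h > 0, ∀ y, |y| ≤ h → ∫⁻ x in {x | 2 * h < |x|}, ‖K (x - y) - K x‖ₑ ≤ B)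
    {c h t : ℝ} (hh : 0 < h) (ht : |t - c| ≤ h) :
    ∫⁻ x in {x | 2 * h < |x - c|}, ‖K (x - t) - K (x - c)‖ₑ ≤ B := by
  refine le_trans (le_of_eq ?_) (hH h hh (t - c) ht)
  have hm : MeasurableSet {x : ℝ | 2 * h < |x|} :=
    measurableSet_lt measurable_const measurable_norm
  have hm' : MeasurableSet {x : ℝ | 2 * h < |x - c|} :=
    measurableSet_lt measurable_const (by fun_prop)
  rw [← lintegral_indicator hm, ← lintegral_indicator hm',
    ← lintegral_sub_right_eq_self ({x : ℝ | 2 * h < |x|}.indicator _) c]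
  congr 1
  ext x
  simp only [Set.indicator, Set.mem_ofPred_eq, sub_sub_sub_cancel_right]

/-- The bad part of a Calderón–Zygmund decomposition is mapped into `L¹` off the dilated
intervals. -/
theorem lintegral_convolution_bad_le {K : ℝ → ℝ} {B : ℝ≥0∞} (hKm : Measurable K)
    (hK : Integrable K)
    (hH : ∀ h > 0, ∀ y, |y| ≤ h → ∫⁻ x in {x | 2 * h < |x|}, ‖K (x - y) - K x‖ₑ ≤ B)
    {S : Set (ℝ × ℝ)} (hS : S.Countable) (hSd : S.PairwiseDisjoint fun q => Set.Ioo q.1 q.2)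
    (hSlt : ∀ q ∈ S, q.1 < q.2) {b : ℝ → ℝ} (hb : Measurable b) (hbi : Integrable b)
    {M : ℝ} (hM : ∀ x, |b x| ≤ M) (hb0 : ∀ x ∉ ⋃ q ∈ S, Set.Ioo q.1 q.2, b x = 0)
    (hbS : ∀ q ∈ S, ∫ x in Set.Ioo q.1 q.2, b x = 0) :
    ∫⁻ x in (⋃ q ∈ S, Metric.closedBall ((q.1 + q.2) / 2) (q.2 - q.1))ᶜ,
      ‖(K ⋆[lsmul ℝ ℝ] b) x‖ₑ ≤ B * ∫⁻ x, ‖b x‖ₑ := by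
  have := hS.to_subtype
  set U := ⋃ q : S, Set.Ioo q.1.1 q.1.2 with hU
  have hUeq : ⋃ q ∈ S, Set.Ioo q.1 q.2 = U := Set.biUnion_eq_iUnion _ _
  rw [hUeq] at hb0
  have hdisj : Pairwise (Function.onFun Disjoint fun q : S => Set.Ioo q.1.1 q.1.2) :=
    hSd.subtype _ _
  set c : S → ℝ := fun q => (q.1.1 + q.1.2) / 2
  have hpt : ∀ x, ‖(K ⋆[lsmul ℝ ℝ] b) x‖ₑ ≤
      ∑' q : S, ∫⁻ t in Set.Ioo q.1.1 q.1.2, ‖K (x - t) - K (x - c q)‖ₑ * ‖b t‖ₑ := by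
    intro x
    have hint := integrable_convolution_integrand_of_bounded hK
      hb.aestronglyMeasurable hM x
    have h1 : (K ⋆[lsmul ℝ ℝ] b) x = ∫ t in U, K (x - t) * b t := by
      rw [convolution_lsmul_swap, setIntegral_eq_integral_of_forall_compl_eq_zero]
      · rfl
      · intro t ht; rw [hb0 t ht, mul_zero]
    have h2 := (hasSum_integral_iUnion (fun q : S => measurableSet_Ioo) hdisj
      (hint.integrableOn (s := U))).tsum_eq
    rw [h1, ← h2]
    refine enorm_tsum_le_tsum_enorm.trans (ENNReal.tsum_le_tsum fun q => ?_)
    -- The mean of `b` over the interval is zero, so the kernel may be replaced by its increment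
    -- from the centre `c q`.
    have h3 : ∫ t in Set.Ioo q.1.1 q.1.2, K (x - t) * b t =
        ∫ t in Set.Ioo q.1.1 q.1.2, (K (x - t) - K (x - c q)) * b t := by
      simp only [sub_mul]
      rw [integral_sub hint.integrableOn (hbi.const_mul _).integrableOn, integral_const_mul,
        hbS _ q.2]
      simp
    rw [h3]
    refine (enorm_integral_le_lintegral_enorm _).trans (le_of_eq ?_)
    simp only [enorm_mul]
  have hmeas : ∀ q : S, Measurable fun z : ℝ × ℝ =>
      ‖K (z.1 - z.2) - K (z.1 - c q)‖ₑ * ‖b z.2‖ₑ := fun q => by fun_prop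
  calc _ ≤ ∫⁻ x in (⋃ q ∈ S, Metric.closedBall ((q.1 + q.2) / 2) (q.2 - q.1))ᶜ,
        ∑' q : S, ∫⁻ t in Set.Ioo q.1.1 q.1.2, ‖K (x - t) - K (x - c q)‖ₑ * ‖b t‖ₑ :=
        lintegral_mono hpt
    _ = ∑' q : S, ∫⁻ x in (⋃ q ∈ S, Metric.closedBall ((q.1 + q.2) / 2) (q.2 - q.1))ᶜ,
        ∫⁻ t in Set.Ioo q.1.1 q.1.2, ‖K (x - t) - K (x - c q)‖ₑ * ‖b t‖ₑ :=
        lintegral_tsum fun q => (hmeas q).lintegral_prod_right'.aemeasurable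
    _ ≤ ∑' q : S, B * ∫⁻ t in Set.Ioo q.1.1 q.1.2, ‖b t‖ₑ := by
        refine ENNReal.tsum_le_tsum fun q => ?_
        rw [lintegral_lintegral_swap (hmeas q).aemeasurable,
          ← lintegral_const_mul _ hb.enorm]
        refine setLIntegral_mono (hb.enorm.const_mul _) fun t ht => ?_
        rw [lintegral_mul_const _ (by fun_prop)]
        gcongr
        -- With `h` half the length of the interval, the removed ball has radius exactly `2 * h`, as
        -- Hörmander's condition asks.
        have hq := hSlt q.1 q.2
        refine le_trans (lintegral_mono_set ?_) (setLIntegral_translate_kernel_le hH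
          (c := c q) (h := (q.1.2 - q.1.1) / 2) (t := t) (by linarith) ?_)
        · intro x hx
          simp only [Set.mem_compl_iff, Set.mem_iUnion, not_exists, Metric.mem_closedBall,
            Real.dist_eq, not_le] at hx
          have := hx q.1 q.2
          simp only [Set.mem_ofPred_eq, c]
          linarith
        · rw [abs_le]
          simp only [c]
          constructor <;> linarith [ht.1, ht.2]
    _ = B * ∫⁻ t in U, ‖b t‖ₑ := by
        rw [ENNReal.tsum_mul_left, lintegral_iUnion (fun q : S => measurableSet_Ioo) hdisj]
    _ ≤ _ := by
        gcongr
        exact Measure.restrict_le_self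

theorem measurable_convolution_real {K g : ℝ → ℝ} (hK : Measurable K) (hg : Measurable g) :
    Measurable (K ⋆[lsmul ℝ ℝ] g) := by
  have h : StronglyMeasurable fun x => ∫ t, K (x - t) * g t :=
    StronglyMeasurable.integral_prod_right (f := fun x t => K (x - t) * g t)
      (by apply Measurable.stronglyMeasurable; fun_prop)
  convert h.measurable using 1
  ext x
  rw [convolution_lsmul_swap]
  rfl

/-- The distributional estimate of Calderón and Zygmund for a convolution operator which is bounded
on `L²` and whose kernel satisfies Hörmander's condition. -/
theorem measure_lt_abs_convolution_le {K : ℝ → ℝ} {A B : ℝ≥0∞} (hKm : Measurable K)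
    (hK : Integrable K)
    (hL2 : ∀ g : ℝ → ℝ, Measurable g → Integrable g → (∃ M, ∀ x, |g x| ≤ M) →
      ∫⁻ x, ‖(K ⋆[lsmul ℝ ℝ] g) x‖ₑ ^ 2 ≤ A * ∫⁻ x, ‖g x‖ₑ ^ 2)
    (hH : ∀ h > 0, ∀ y, |y| ≤ h → ∫⁻ x in {x | 2 * h < |x|}, ‖K (x - y) - K x‖ₑ ≤ B)
    {f : ℝ → ℝ} (hf : Continuous f) (hfc : HasCompactSupport f) (hf0 : ∀ x, 0 ≤ f x)
    {l : ℝ} (hl : 0 < l) :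
    volume {x | 2 * l < |(K ⋆[lsmul ℝ ℝ] f) x|} ≤
      (A + 2 + 2 * B) * (2 * (ENNReal.ofReal l)⁻¹ * ∫⁻ x in {x | l / 2 < f x}, ‖f x‖ₑ) +
        A * ((ENNReal.ofReal l)⁻¹ ^ 2 * ∫⁻ x in {x | f x ≤ l}, ‖f x‖ₑ ^ 2) := by
  obtain ⟨S, hSc, hSd, hS, hSf⟩ := exists_calderon_zygmund_intervals hf hfc hf0 hl
  have := hSc.to_subtype
  set U := ⋃ q ∈ S, Set.Ioo q.1 q.2 with hU
  have hUm : MeasurableSet U := .biUnion hSc fun _ _ => measurableSet_Ioo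
  have hUeq : U = ⋃ q : S, Set.Ioo q.1.1 q.1.2 := Set.biUnion_eq_iUnion _ _
  have hdisj : Pairwise (Function.onFun Disjoint fun q : S => Set.Ioo q.1.1 q.1.2) :=
    hSd.subtype _ _
  have hfi : Integrable f := hf.integrable_of_hasCompactSupport hfc
  obtain ⟨M, hM⟩ := hfc.exists_bound_of_continuous hf
  set L := ENNReal.ofReal l with hL
  have hL0 : L ≠ 0 := by simpa [hL] using hl
  have hLt : L ≠ ∞ := ENNReal.ofReal_ne_top
  have hle : ‖l‖ₑ = L := Real.enorm_of_nonneg hl.le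
  have hvU : volume U = ∑' q : S, ENNReal.ofReal (q.1.2 - q.1.1) := by
    rw [hUeq, measure_iUnion hdisj fun _ => measurableSet_Ioo]
    simp
  have hSint : ∀ q ∈ S, ∫ x in Set.Ioo q.1 q.2, f x = l * (q.2 - q.1) := fun q hq => by
    rw [← (hS q hq).2, intervalIntegral.integral_of_le (hS q hq).1.le, integral_Ioc_eq_integral_Ioo]
  have hmean : ∫⁻ x in U, ‖f x‖ₑ = L * volume U := by
    rw [hUeq, lintegral_iUnion (fun _ => measurableSet_Ioo) hdisj, ← hUeq, hvU,
      ← ENNReal.tsum_mul_left]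
    congr 1
    ext q
    rw [← ENNReal.ofReal_mul hl.le, ← hSint q.1 q.2,
      ofReal_integral_eq_lintegral_ofReal hfi.integrableOn (ae_of_all _ hf0)]
    simp only [Real.enorm_of_nonneg (hf0 _)]
  have hUfin : volume U ≠ ∞ := by
    intro h
    have h1 : ∫⁻ x in U, ‖f x‖ₑ < ∞ := hfi.integrableOn.2
    rw [hmean, h, ENNReal.mul_top hL0] at h1
    exact lt_irrefl _ h1
  -- The points with `f ≤ l / 2` carry at most half of `∫ f = l * |U|` over `U`, so the points with
  -- `f > l / 2` carry the other half. The finite term `L * volume U` is added to both sides to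
  -- avoid subtraction.
  have hUle : volume U ≤ 2 * L⁻¹ * ∫⁻ x in {x | l / 2 < f x}, ‖f x‖ₑ := by
    have h1 : L * volume U + L * volume U ≤
        2 * (∫⁻ x in {x | l / 2 < f x}, ‖f x‖ₑ) + L * volume U := by
      rw [← two_mul, ← hmean, ← lintegral_const_mul _ (by fun_prop),
        ← lintegral_const_mul _ (by fun_prop), hmean, ← setLIntegral_const,
        ← lintegral_indicator (measurableSet_lt measurable_const hf.measurable)]
      refine le_trans ?_ (add_le_add_left (setLIntegral_le_lintegral U _) _)
      rw [← lintegral_add_right _ measurable_const]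
      refine lintegral_mono fun x => ?_
      by_cases hx : l / 2 < f x
      · simp [Set.indicator, hx]
      · simp only [Set.indicator, Set.mem_ofPred_eq, hx, if_false, zero_add,
          Real.enorm_of_nonneg (hf0 x), hL]
        rw [← ENNReal.ofReal_ofNat 2, ← ENNReal.ofReal_mul (by norm_num)]
        exact ENNReal.ofReal_le_ofReal (by linarith)
    have h2 := (ENNReal.add_le_add_iff_right (ENNReal.mul_ne_top hLt hUfin)).1 h1
    calc volume U = L⁻¹ * (L * volume U) := by
          rw [← mul_assoc, ENNReal.inv_mul_cancel hL0 hLt, one_mul]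
      _ ≤ L⁻¹ * (2 * ∫⁻ x in {x | l / 2 < f x}, ‖f x‖ₑ) := by gcongr
      _ = _ := by ring
  -- Subtracting the constant `l` gives `b` mean zero on every interval, because each mean of `f` is
  -- exactly `l`; the good part equals `l` on `U` and `f ≤ l` off it.
  set b : ℝ → ℝ := U.indicator fun x => f x - l with hb
  set g : ℝ → ℝ := fun x => f x - b x with hg
  have hbm : Measurable b := (hf.measurable.sub_const l).indicator hUm
  have hgm : Measurable g := hf.measurable.sub hbm
  have hbi : Integrable b := by
    rw [integrable_indicator_iff hUm]
    exact hfi.integrableOn.sub (integrableOn_const hUfin)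
  have hgi : Integrable g := hfi.sub hbi
  have hbM : ∀ x, |b x| ≤ M + l := fun x => by
    have := hM x
    rw [Real.norm_eq_abs] at this
    by_cases hx : x ∈ U
    · simp only [hb, Set.indicator_of_mem hx]
      exact (abs_sub _ _).trans (by rw [abs_of_pos hl]; linarith)
    · simp only [hb, Set.indicator_of_notMem hx, abs_zero]
      linarith [abs_nonneg (f x)]
  have hgU : ∀ x ∈ U, g x = l := fun x hx => by simp [hg, hb, hx]
  have hgU' : ∀ x ∉ U, g x = f x := fun x hx => by simp [hg, hb, hx]
  have hgM : ∀ x, |g x| ≤ l := fun x => by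
    by_cases hx : x ∈ U
    · rw [hgU x hx, abs_of_pos hl]
    · rw [hgU' x hx, abs_of_nonneg (hf0 x)]
      exact hSf x hx
  have hTf : K ⋆[lsmul ℝ ℝ] f = K ⋆[lsmul ℝ ℝ] g + K ⋆[lsmul ℝ ℝ] b := by
    rw [eq_comm, ← eq_sub_iff_add_eq]
    exact convolution_sub_of_bounded hK hf.aestronglyMeasurable hbm.aestronglyMeasurable
      (fun x => hM x) hbM
  have hb1 : ∫⁻ x, ‖b x‖ₑ ≤ 2 * (L * volume U) := by
    have h1 : ∫⁻ x, ‖b x‖ₑ = ∫⁻ x in U, ‖f x - l‖ₑ := by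
      rw [← lintegral_indicator hUm]
      congr 1
      ext x
      by_cases hx : x ∈ U <;> simp [hb, hx]
    rw [h1, two_mul]
    nth_rw 1 [← hmean]
    rw [← setLIntegral_const, ← lintegral_add_right _ measurable_const, ← hle]
    exact lintegral_mono fun x => enorm_sub_le
  have hg2 : ∫⁻ x, ‖g x‖ₑ ^ 2 ≤ L ^ 2 * volume U + ∫⁻ x in {x | f x ≤ l}, ‖f x‖ₑ ^ 2 := by
    rw [← lintegral_add_compl _ hUm]
    gcongr ?_ + ?_
    · rw [← setLIntegral_const]
      exact setLIntegral_mono measurable_const fun x hx => by rw [hgU x hx, hle]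
    · refine (setLIntegral_mono (by fun_prop) fun x hx => ?_).trans
        (lintegral_mono_set (f := fun x => ‖f x‖ₑ ^ 2) fun x hx => hSf x hx)
      rw [hgU' x hx]
  set E := ⋃ q ∈ S, Metric.closedBall ((q.1 + q.2) / 2) (q.2 - q.1) with hE
  have hEle : volume E ≤ 2 * volume U := by
    rw [hE, Set.biUnion_eq_iUnion, hvU, ← ENNReal.tsum_mul_left]
    refine (measure_iUnion_le _).trans (ENNReal.tsum_le_tsum fun q => ?_)
    rw [Real.volume_closedBall, ENNReal.ofReal_mul (by norm_num), ENNReal.ofReal_ofNat]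
  have hTb : volume ({x | L ≤ ‖(K ⋆[lsmul ℝ ℝ] b) x‖ₑ} ∩ Eᶜ) ≤ 2 * B * volume U := by
    have h1 := lintegral_convolution_bad_le hKm hK hH hSc hSd (fun q hq => (hS q hq).1) hbm hbi hbM
      (fun x hx => Set.indicator_of_notMem hx _) (fun q hq => by
        have h : Set.EqOn b (fun x => f x - l) (Set.Ioo q.1 q.2) := fun x hx =>
          Set.indicator_of_mem (Set.mem_biUnion hq hx) _
        rw [setIntegral_congr_fun measurableSet_Ioo h,
          integral_sub hfi.integrableOn (integrableOn_const (by simp)), hSint q hq]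
        simp [(hS q hq).1.le, mul_comm])
    have h2 := meas_ge_le_lintegral_div (μ := volume.restrict Eᶜ)
      (measurable_convolution_real hKm hbm).enorm.aemeasurable hL0 hLt
    rw [Measure.restrict_apply (measurableSet_le measurable_const
      (measurable_convolution_real hKm hbm).enorm)] at h2
    refine h2.trans (ENNReal.div_le_of_le_mul (h1.trans ?_))
    calc _ ≤ B * (2 * (L * volume U)) := by gcongr
      _ = _ := by ring
  have hTg : volume {x | L ≤ ‖(K ⋆[lsmul ℝ ℝ] g) x‖ₑ} ≤
      A * (volume U + L⁻¹ ^ 2 * ∫⁻ x in {x | f x ≤ l}, ‖f x‖ₑ ^ 2) := by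
    have h1 := meas_ge_le_lintegral_div (μ := volume)
      ((measurable_convolution_real hKm hgm).enorm.pow_const 2).aemeasurable
      (pow_ne_zero 2 hL0) (ENNReal.pow_ne_top hLt)
    refine le_trans (measure_mono fun x hx => ?_) (h1.trans (ENNReal.div_le_of_le_mul
      ((hL2 g hgm hgi ⟨l, hgM⟩).trans ?_)))
    · exact pow_le_pow_left' (show L ≤ ‖(K ⋆[lsmul ℝ ℝ] g) x‖ₑ from hx) 2
    · calc _ ≤ A * (L ^ 2 * volume U + ∫⁻ x in {x | f x ≤ l}, ‖f x‖ₑ ^ 2) := by gcongr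
        _ = A * (L ^ 2 * volume U + (L⁻¹ * L) ^ 2 * ∫⁻ x in {x | f x ≤ l}, ‖f x‖ₑ ^ 2) := by
            rw [ENNReal.inv_mul_cancel hL0 hLt, one_pow, one_mul]
        _ = _ := by ring
  have hsub : {x | 2 * l < |(K ⋆[lsmul ℝ ℝ] f) x|} ⊆ {x | L ≤ ‖(K ⋆[lsmul ℝ ℝ] g) x‖ₑ} ∪
      (E ∪ ({x | L ≤ ‖(K ⋆[lsmul ℝ ℝ] b) x‖ₑ} ∩ Eᶜ)) := by
    intro x hx
    simp only [Set.mem_ofPred_eq, hTf, Pi.add_apply] at hx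
    simp only [Set.mem_union, Set.mem_inter_iff, Set.mem_ofPred_eq, Set.mem_compl_iff,
      Real.enorm_eq_ofReal_abs, hL, ENNReal.ofReal_le_ofReal_iff (abs_nonneg _)]
    by_contra! h
    have h3 := h.2.2
    by_cases hxE : x ∈ E
    · exact h.2.1 hxE
    · by_cases hb' : l ≤ |(K ⋆[lsmul ℝ ℝ] b) x|
      · exact hxE (h.2.2 hb')
      · linarith [abs_add_le ((K ⋆[lsmul ℝ ℝ] g) x) ((K ⋆[lsmul ℝ ℝ] b) x), h.1]
  calc _ ≤ _ := measure_mono hsub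
    _ ≤ A * (volume U + L⁻¹ ^ 2 * ∫⁻ x in {x | f x ≤ l}, ‖f x‖ₑ ^ 2) +
        (2 * volume U + 2 * B * volume U) :=
        (measure_union_le _ _).trans (add_le_add hTg ((measure_union_le _ _).trans
          (add_le_add hEle hTb)))
    _ = (A + 2 + 2 * B) * volume U +
        A * (L⁻¹ ^ 2 * ∫⁻ x in {x | f x ≤ l}, ‖f x‖ₑ ^ 2) := by ring
    _ ≤ _ := by gcongr

/-! ### Interpolation to `1 < p ≤ 2`. -/

theorem setLIntegral_Ioo_zero_rpow {s a : ℝ} (hs : -1 < s) (ha : 0 ≤ a) :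
    ∫⁻ t in Set.Ioo 0 a, ENNReal.ofReal (t ^ s) = ENNReal.ofReal (a ^ (s + 1) / (s + 1)) := by
  have hi : IntegrableOn (fun t : ℝ => t ^ s) (Set.Ioo 0 a) :=
    ((intervalIntegral.intervalIntegrable_rpow' hs (a := 0) (b := a)).1).mono_set
      Set.Ioo_subset_Ioc_self
  rw [← ofReal_integral_eq_lintegral_ofReal hi, ← integral_Ioc_eq_integral_Ioo,
    ← intervalIntegral.integral_of_le ha, integral_rpow (Or.inl hs),
    Real.zero_rpow (by linarith), sub_zero]
  exact (ae_restrict_mem measurableSet_Ioo).mono fun t ht => Real.rpow_nonneg ht.1.le _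

theorem setLIntegral_Ici_rpow {s a : ℝ} (hs : s < -1) (ha : 0 < a) :
    ∫⁻ t in Set.Ici a, ENNReal.ofReal (t ^ s) = ENNReal.ofReal (-a ^ (s + 1) / (s + 1)) := by
  rw [setLIntegral_congr Ioi_ae_eq_Ici.symm,
    ← ofReal_integral_eq_lintegral_ofReal (integrableOn_Ioi_rpow_of_lt hs ha),
    integral_Ioi_rpow_of_lt hs ha]
  exact (ae_restrict_mem measurableSet_Ioi).mono fun t ht =>
    Real.rpow_nonneg (ha.trans (Set.mem_Ioi.1 ht)).le _

/-- Kernels on the line whose convolution operator is bounded on `L²` and which satisfy Hörmander's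
regularity condition, with explicit constants. -/
structure IsHormanderKernel (K : ℝ → ℝ) (A B : ℝ≥0∞) : Prop where
  measurable : Measurable K
  integrable : Integrable K
  lintegral_sq_le : ∀ g : ℝ → ℝ, Measurable g → Integrable g → (∃ M, ∀ x, |g x| ≤ M) →
    ∫⁻ x, ‖(K ⋆[lsmul ℝ ℝ] g) x‖ₑ ^ 2 ≤ A * ∫⁻ x, ‖g x‖ₑ ^ 2
  hormander : ∀ h > 0, ∀ y, |y| ≤ h → ∫⁻ x in {x | 2 * h < |x|}, ‖K (x - y) - K x‖ₑ ≤ B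

/-- Interpolation of the Calderón–Zygmund estimate, `1 < p < 2`, nonnegative functions. -/
theorem exists_lintegral_rpow_convolution_le {A B : ℝ≥0∞} (hA : A ≠ ∞) (hB : B ≠ ∞) {p : ℝ}
    (hp : 1 < p) (hp2 : p < 2) :
    ∃ C : ℝ≥0∞, C ≠ ∞ ∧ ∀ K, IsHormanderKernel K A B → ∀ f : ℝ → ℝ, Continuous f →
      HasCompactSupport f → (∀ x, 0 ≤ f x) →
      ∫⁻ x, ‖(K ⋆[lsmul ℝ ℝ] f) x‖ₑ ^ p ≤ C * ∫⁻ x, ‖f x‖ₑ ^ p := by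
  set c₁ : ℝ≥0∞ := (A + 2 + 2 * B) * 2 with hc₁
  -- `d₁` and `d₂` are the integrals of `2 t^(p-2)` over `(0, 4)` and of `4 t^(p-3)` over `(2, ∞)`;
  -- they are finite because `p > 1` and `p < 2` respectively.
  set d₁ : ℝ≥0∞ := ENNReal.ofReal (2 * 4 ^ (p - 1) / (p - 1)) with hd₁
  set d₂ : ℝ≥0∞ := ENNReal.ofReal (4 * 2 ^ (p - 2) / (2 - p)) with hd₂
  refine ⟨ENNReal.ofReal p * (c₁ * d₁ + A * d₂), by finiteness, fun K hK f hf hfc hf0 => ?_⟩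
  have hTm : Measurable (K ⋆[lsmul ℝ ℝ] f) :=
    measurable_convolution_real hK.measurable hf.measurable
  have hlayer : ∫⁻ x, ‖(K ⋆[lsmul ℝ ℝ] f) x‖ₑ ^ p = ENNReal.ofReal p * ∫⁻ t in Set.Ioi 0,
      volume {x | t < |(K ⋆[lsmul ℝ ℝ] f) x|} * ENNReal.ofReal (t ^ (p - 1)) := by
    rw [← lintegral_rpow_eq_lintegral_meas_lt_mul volume (ae_of_all _ fun x => abs_nonneg _)
      (by fun_prop) (by linarith)]
    simp only [Real.enorm_eq_ofReal_abs]
    congr 1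
    ext x
    rw [ENNReal.ofReal_rpow_of_nonneg (abs_nonneg _) (by linarith)]
  have hm1 : MeasurableSet {z : ℝ × ℝ | z.1 / 2 / 2 < f z.2} :=
    measurableSet_lt (by fun_prop) (by fun_prop)
  have hm2 : MeasurableSet {z : ℝ × ℝ | f z.2 ≤ z.1 / 2} :=
    measurableSet_le (by fun_prop) (by fun_prop)
  -- The two terms of the distributional estimate at level `l = t / 2`, weighted by `t^(p-1)`, as
  -- functions of `(t, x)`. Tonelli then integrates in `t` first: `t < 4 f x` in one, `t ≥ 2 f x` in
  -- the other.
  set F₁ : ℝ → ℝ → ℝ≥0∞ := fun t x => {z : ℝ × ℝ | z.1 / 2 / 2 < f z.2}.indicator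
    (fun z => ENNReal.ofReal (2 * z.1 ^ (p - 2)) * ‖f z.2‖ₑ) (t, x) with hF₁
  set F₂ : ℝ → ℝ → ℝ≥0∞ := fun t x => {z : ℝ × ℝ | f z.2 ≤ z.1 / 2}.indicator
    (fun z => ENNReal.ofReal (4 * z.1 ^ (p - 3)) * ‖f z.2‖ₑ ^ 2) (t, x) with hF₂
  have hF₁' : ∀ t x, F₁ t x =
      if t / 2 / 2 < f x then ENNReal.ofReal (2 * t ^ (p - 2)) * ‖f x‖ₑ else 0 :=
    fun _ _ => rfl
  have hF₂' : ∀ t x, F₂ t x =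
      if f x ≤ t / 2 then ENNReal.ofReal (4 * t ^ (p - 3)) * ‖f x‖ₑ ^ 2 else 0 :=
    fun _ _ => rfl
  have hF₁m : Measurable (Function.uncurry F₁) := by
    refine Measurable.indicator (f := fun z : ℝ × ℝ => ENNReal.ofReal (2 * z.1 ^ (p - 2)) *
      ‖f z.2‖ₑ) ?_ hm1
    have := hf.measurable
    fun_prop
  have hF₂m : Measurable (Function.uncurry F₂) := by
    refine Measurable.indicator (f := fun z : ℝ × ℝ => ENNReal.ofReal (4 * z.1 ^ (p - 3)) *
      ‖f z.2‖ₑ ^ 2) ?_ hm2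
    have := hf.measurable
    fun_prop
  have hpt : ∀ t ∈ Set.Ioi (0 : ℝ),
      volume {x | t < |(K ⋆[lsmul ℝ ℝ] f) x|} * ENNReal.ofReal (t ^ (p - 1)) ≤
        c₁ * (∫⁻ x, F₁ t x) + A * ∫⁻ x, F₂ t x := by
    intro t ht
    have ht : 0 < t := ht
    have h := measure_lt_abs_convolution_le hK.measurable hK.integrable hK.lintegral_sq_le
      hK.hormander hf hfc hf0 (half_pos ht)
    rw [mul_div_cancel₀ _ (two_ne_zero)] at h
    have hinv : (ENNReal.ofReal (t / 2))⁻¹ = ENNReal.ofReal (2 / t) := by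
      rw [← ENNReal.ofReal_inv_of_pos (half_pos ht), inv_div]
    have e1 : (ENNReal.ofReal (t / 2))⁻¹ * ENNReal.ofReal (t ^ (p - 1)) =
        ENNReal.ofReal (2 * t ^ (p - 2)) := by
      rw [hinv, ← ENNReal.ofReal_mul (by positivity), show p - 1 = (p - 2) + 1 by ring,
        Real.rpow_add_one ht.ne']
      congr 1; field_simp
    have e2 : (ENNReal.ofReal (t / 2))⁻¹ ^ 2 * ENNReal.ofReal (t ^ (p - 1)) =
        ENNReal.ofReal (4 * t ^ (p - 3)) := by
      rw [hinv, ← ENNReal.ofReal_pow (by positivity), ← ENNReal.ofReal_mul (by positivity),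
        show p - 1 = (p - 3) + 1 + 1 by ring, Real.rpow_add_one ht.ne', Real.rpow_add_one ht.ne']
      congr 1; field_simp; norm_num
    have i1 : ∫⁻ x, F₁ t x =
        ENNReal.ofReal (2 * t ^ (p - 2)) * ∫⁻ x in {x | t / 2 / 2 < f x}, ‖f x‖ₑ := by
      rw [← lintegral_const_mul _ (by fun_prop), ← lintegral_indicator
        (measurableSet_lt measurable_const hf.measurable)]
      rfl
    have i2 : ∫⁻ x, F₂ t x =
        ENNReal.ofReal (4 * t ^ (p - 3)) * ∫⁻ x in {x | f x ≤ t / 2}, ‖f x‖ₑ ^ 2 := by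
      rw [← lintegral_const_mul _ (by fun_prop), ← lintegral_indicator
        (measurableSet_le hf.measurable measurable_const)]
      rfl
    rw [i1, i2, ← e1, ← e2]
    refine (mul_le_mul_left h _).trans (le_of_eq ?_)
    rw [hc₁]
    ring
  have j1 : ∫⁻ t in Set.Ioi 0, ∫⁻ x, F₁ t x ≤ d₁ * ∫⁻ x, ‖f x‖ₑ ^ p := by
    rw [lintegral_lintegral_swap hF₁m.aemeasurable,
      ← lintegral_const_mul _ (by fun_prop)]
    refine lintegral_mono fun x => ?_
    have hx := hf0 x
    have : ∫⁻ t in Set.Ioi 0, F₁ t x =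
        ∫⁻ t in Set.Ioo 0 (4 * f x), ENNReal.ofReal (t ^ (p - 2)) * (2 * ‖f x‖ₑ) := by
      rw [← lintegral_indicator measurableSet_Ioi, ← lintegral_indicator measurableSet_Ioo]
      congr 1
      ext t
      simp only [Set.indicator, Set.mem_Ioi, Set.mem_Ioo, hF₁']
      have e : ENNReal.ofReal (2 * t ^ (p - 2)) * ‖f x‖ₑ =
          ENNReal.ofReal (t ^ (p - 2)) * (2 * ‖f x‖ₑ) := by
        rw [ENNReal.ofReal_mul (by norm_num), ENNReal.ofReal_ofNat]
        ring
      by_cases ht : 0 < t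
      · by_cases ht' : t < 4 * f x
        · rw [if_pos ht, if_pos (c := t / 2 / 2 < f x) (by linarith), if_pos ⟨ht, ht'⟩, e]
        · rw [if_pos ht, if_neg (c := t / 2 / 2 < f x) (by linarith), if_neg (fun h => ht' h.2)]
      · rw [if_neg ht, if_neg (fun h => ht h.1)]
    rw [this, lintegral_mul_const _ (by fun_prop),
      setLIntegral_Ioo_zero_rpow (by linarith) (by positivity), Real.enorm_of_nonneg hx,
      ENNReal.ofReal_rpow_of_nonneg hx (by linarith), hd₁, ← ENNReal.ofReal_ofNat 2,
      ← ENNReal.ofReal_mul (by norm_num),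
      ← ENNReal.ofReal_mul (by have : 0 < p - 2 + 1 := by linarith
                               positivity),
      ← ENNReal.ofReal_mul (by have : 0 < p - 1 := by linarith
                               positivity)]
    refine le_of_eq (congrArg _ ?_)
    rw [show p - 2 + 1 = p - 1 by ring, Real.mul_rpow (by norm_num) hx]
    have : f x ^ p = f x ^ (p - 1) * f x := by
      rw [← Real.rpow_add_one' hx (by linarith)]; congr 1; ring
    rw [this]
    ring
  have j2 : ∫⁻ t in Set.Ioi 0, ∫⁻ x, F₂ t x ≤ d₂ * ∫⁻ x, ‖f x‖ₑ ^ p := by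
    rw [lintegral_lintegral_swap hF₂m.aemeasurable,
      ← lintegral_const_mul _ (by fun_prop)]
    refine lintegral_mono fun x => ?_
    -- Zeros of `f` are set aside since `t^(p-3)` is not integrable down to `t = 0`.
    rcases (hf0 x).eq_or_lt with hx | hx
    · have : ∀ t, F₂ t x = 0 := fun t => by
        simp [hF₂', ← hx]
      simp [this]
    have : ∫⁻ t in Set.Ioi 0, F₂ t x =
        ∫⁻ t in Set.Ici (2 * f x), ENNReal.ofReal (t ^ (p - 3)) * (4 * ‖f x‖ₑ ^ 2) := by
      rw [← lintegral_indicator measurableSet_Ioi, ← lintegral_indicator measurableSet_Ici]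
      congr 1
      ext t
      simp only [Set.indicator, Set.mem_Ioi, Set.mem_Ici, hF₂']
      have e : ENNReal.ofReal (4 * t ^ (p - 3)) * ‖f x‖ₑ ^ 2 =
          ENNReal.ofReal (t ^ (p - 3)) * (4 * ‖f x‖ₑ ^ 2) := by
        rw [ENNReal.ofReal_mul (by norm_num), ENNReal.ofReal_ofNat]
        ring
      by_cases ht : 2 * f x ≤ t
      · rw [if_pos (c := 0 < t) (by linarith), if_pos (c := f x ≤ t / 2) (by linarith), if_pos ht, e]
      · rw [if_neg ht, if_neg (c := f x ≤ t / 2) (by linarith), ite_self]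
    have h2p : 0 < 2 - p := by linarith
    rw [this, lintegral_mul_const _ (by fun_prop),
      setLIntegral_Ici_rpow (by linarith) (by positivity), Real.enorm_of_nonneg hx.le,
      ENNReal.ofReal_rpow_of_nonneg hx.le (by linarith), hd₂, ← ENNReal.ofReal_ofNat 4,
      ← ENNReal.ofReal_pow hx.le, ← ENNReal.ofReal_mul (by norm_num),
      ← ENNReal.ofReal_mul (by
        rw [show p - 3 + 1 = -(2 - p) by ring, neg_div_neg_eq]; positivity),
      ← ENNReal.ofReal_mul (by positivity)]
    refine le_of_eq (congrArg _ ?_)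
    have e : f x ^ p = f x ^ (p - 2) * f x * f x := by
      rw [← Real.rpow_add_one hx.ne', ← Real.rpow_add_one hx.ne']; congr 1; ring
    rw [e, show p - 3 + 1 = p - 2 by ring, Real.mul_rpow (by norm_num) hx.le,
      ← neg_sub p 2, div_neg, neg_div]
    ring
  rw [hlayer, mul_assoc]
  gcongr
  have hG₁ : Measurable fun t => ∫⁻ x, F₁ t x := hF₁m.lintegral_prod_right'
  have hG₂ : Measurable fun t => ∫⁻ x, F₂ t x := hF₂m.lintegral_prod_right'
  calc _ ≤ ∫⁻ t in Set.Ioi 0, (c₁ * (∫⁻ x, F₁ t x) + A * ∫⁻ x, F₂ t x) :=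
        setLIntegral_mono ((hG₁.const_mul _).add (hG₂.const_mul _)) hpt
    _ = c₁ * (∫⁻ t in Set.Ioi 0, ∫⁻ x, F₁ t x) + A * ∫⁻ t in Set.Ioi 0, ∫⁻ x, F₂ t x := by
        rw [lintegral_add_left (hG₁.const_mul _), lintegral_const_mul _ hG₁,
          lintegral_const_mul _ hG₂]
    _ ≤ c₁ * (d₁ * ∫⁻ x, ‖f x‖ₑ ^ p) + A * (d₂ * ∫⁻ x, ‖f x‖ₑ ^ p) := by gcongr
    _ = _ := by ring

theorem eLpNorm_ofReal_le_of_lintegral_rpow_le {α E : Type*} [MeasurableSpace α] {μ : Measure α}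
    [NormedAddCommGroup E] {u f : α → E} {p : ℝ} (hp : 0 < p) {C : ℝ≥0∞}
    (h : ∫⁻ x, ‖u x‖ₑ ^ p ∂μ ≤ C * ∫⁻ x, ‖f x‖ₑ ^ p ∂μ) :
    eLpNorm u (ENNReal.ofReal p) μ ≤ C ^ (1 / p) * eLpNorm f (ENNReal.ofReal p) μ := by
  have hp0 : ENNReal.ofReal p ≠ 0 := by simpa using hp
  rw [eLpNorm_eq_lintegral_rpow_enorm_toReal hp0 ENNReal.ofReal_ne_top,
    eLpNorm_eq_lintegral_rpow_enorm_toReal hp0 ENNReal.ofReal_ne_top,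
    ENNReal.toReal_ofReal hp.le, ← ENNReal.mul_rpow_of_nonneg _ _ (by positivity)]
  exact ENNReal.rpow_le_rpow h (by positivity)

/-- `L^p` bounds, `1 < p ≤ 2`, for real functions. -/
theorem exists_eLpNorm_convolution_le_of_le_two {A B : ℝ≥0∞} (hA : A ≠ ∞) (hB : B ≠ ∞) {p : ℝ}
    (hp : 1 < p) (hp2 : p ≤ 2) :
    ∃ C : ℝ≥0∞, C ≠ ∞ ∧ ∀ K, IsHormanderKernel K A B → ∀ f : ℝ → ℝ, Continuous f →
      HasCompactSupport f →
      eLpNorm (K ⋆[lsmul ℝ ℝ] f) (ENNReal.ofReal p) volume ≤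
        C * eLpNorm f (ENNReal.ofReal p) volume := by
  have hp0 : 0 < p := by linarith
  rcases hp2.eq_or_lt with rfl | hp2
  · refine ⟨A ^ (1 / 2 : ℝ), by finiteness, fun K hK f hf hfc => ?_⟩
    refine eLpNorm_ofReal_le_of_lintegral_rpow_le hp0 ?_
    have := hK.lintegral_sq_le f hf.measurable (hf.integrable_of_hasCompactSupport hfc)
      (hfc.exists_bound_of_continuous hf)
    exact_mod_cast this
  · obtain ⟨C, hC, h⟩ := exists_lintegral_rpow_convolution_le hA hB hp hp2
    refine ⟨C ^ (1 / p) * 2, by finiteness, fun K hK f hf hfc => ?_⟩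
    -- To be applied to the positive and negative parts of `f`, which accounts for the factor `2`.
    have h1 : ∀ g : ℝ → ℝ, Continuous g → HasCompactSupport g → (∀ x, 0 ≤ g x) →
        (∀ x, |g x| ≤ |f x|) → eLpNorm (K ⋆[lsmul ℝ ℝ] g) (ENNReal.ofReal p) volume ≤
          C ^ (1 / p) * eLpNorm f (ENNReal.ofReal p) volume := fun g hg hgc hg0 hgf => by
      refine (eLpNorm_ofReal_le_of_lintegral_rpow_le hp0 (h K hK g hg hgc hg0)).trans ?_
      gcongr
      exact eLpNorm_mono hgf
    have hc1 : Continuous fun x => max (f x) 0 := by fun_prop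
    have hc2 : Continuous fun x => max (-f x) 0 := by fun_prop
    have hs1 : HasCompactSupport fun x => max (f x) 0 :=
      hfc.comp_left (g := fun y => max y 0) (by simp)
    have hs2 : HasCompactSupport fun x => max (-f x) 0 :=
      hfc.comp_left (g := fun y => max (-y) 0) (by simp)
    have hl1 : ∀ x, |max (f x) 0| ≤ |f x| := fun x => by
      rw [abs_of_nonneg (le_max_right _ _)]; exact max_le (le_abs_self _) (abs_nonneg _)
    have hl2 : ∀ x, |max (-f x) 0| ≤ |f x| := fun x => by
      rw [abs_of_nonneg (le_max_right _ _)]; exact max_le (neg_le_abs _) (abs_nonneg _)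
    obtain ⟨M, hM⟩ := hfc.exists_bound_of_continuous hf
    have hsub : K ⋆[lsmul ℝ ℝ] f = K ⋆[lsmul ℝ ℝ] (fun x => max (f x) 0) -
        K ⋆[lsmul ℝ ℝ] (fun x => max (-f x) 0) := by
      rw [← convolution_sub_of_bounded hK.integrable hc1.aestronglyMeasurable
        hc2.aestronglyMeasurable (fun x => (hl1 x).trans (hM x)) (fun x => (hl2 x).trans (hM x))]
      congr 1
      ext x
      rcases le_total 0 (f x) with h0 | h0
      · rw [max_eq_left h0, max_eq_right (by linarith), sub_zero]
      · rw [max_eq_right h0, max_eq_left (by linarith)]; ring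
    rw [hsub]
    refine (eLpNorm_sub_le (measurable_convolution_real hK.measurable
      hc1.measurable).aestronglyMeasurable (measurable_convolution_real hK.measurable
      hc2.measurable).aestronglyMeasurable (by simpa using hp.le)).trans ?_
    refine (add_le_add (h1 _ hc1 hs1 (fun x => le_max_right _ _) hl1)
      (h1 _ hc2 hs2 (fun x => le_max_right _ _) hl2)).trans (le_of_eq ?_)
    ring

/-! ### Duality for `p > 2` and complex-valued functions. -/

/-- Fubini: an even real kernel makes the operator its own transpose. -/
theorem integral_convolution_mul_eq {K f g : ℝ → ℝ} (hK : Integrable K)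
    (hKe : ∀ x, K (-x) = K x) (hf : Continuous f) (hfc : HasCompactSupport f)
    (hg : Continuous g) (hgc : HasCompactSupport g) :
    ∫ x, (K ⋆[lsmul ℝ ℝ] f) x * g x = ∫ x, f x * (K ⋆[lsmul ℝ ℝ] g) x := by
  obtain ⟨M, hM⟩ := hgc.exists_bound_of_continuous hg
  have hint : Integrable (fun z : ℝ × ℝ => f z.2 * K (z.1 - z.2) * g z.1) (volume.prod volume) :=
    (Integrable.convolution_integrand (lsmul ℝ ℝ) (hf.integrable_of_hasCompactSupport hfc)
      hK).mul_bdd (by fun_prop) (ae_of_all _ fun z => hM z.1)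
  calc _ = ∫ x, ∫ y, f y * K (x - y) * g x := by
        congr 1
        ext x
        rw [convolution_lsmul_swap, ← integral_mul_const]
        simp only [smul_eq_mul, mul_comm]
    _ = ∫ y, ∫ x, f y * K (x - y) * g x := integral_integral_swap hint
    _ = _ := by
        congr 1
        ext y
        rw [convolution_lsmul_swap, ← integral_const_mul]
        congr 1
        ext x
        rw [← hKe, neg_sub, smul_eq_mul, mul_assoc]

/-- `L^p` bounds, `2 < p < ∞`, for real functions, by duality. -/
theorem exists_eLpNorm_convolution_le_of_two_lt {A B : ℝ≥0∞} (hA : A ≠ ∞) (hB : B ≠ ∞) {p : ℝ}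
    (hp : 2 < p) :
    ∃ C : ℝ≥0∞, C ≠ ∞ ∧ ∀ K, IsHormanderKernel K A B → (∀ x, K (-x) = K x) →
      HasCompactSupport K → ∀ f : ℝ → ℝ, Continuous f → HasCompactSupport f →
      eLpNorm (K ⋆[lsmul ℝ ℝ] f) (ENNReal.ofReal p) volume ≤
        C * eLpNorm f (ENNReal.ofReal p) volume := by
  set q := p / (p - 1) with hq
  have hpq : p.HolderConjugate q := Real.HolderConjugate.conjExponent (by linarith)
  obtain ⟨C, hC, h⟩ := exists_eLpNorm_convolution_le_of_le_two hA hB hpq.symm.lt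
    (by rw [hq, div_le_iff₀ (by linarith)]; linarith)
  refine ⟨C, hC, fun K hK hKe hKc f hf hfc => ?_⟩
  set u := K ⋆[lsmul ℝ ℝ] f with hu
  have huc : Continuous u :=
    hfc.continuous_convolution_right _ hK.integrable.locallyIntegrable hf
  have hus : HasCompactSupport u := hKc.convolution _ hfc
  -- The extremal function for Hölder's inequality: `u g = |u|^p` and `|g|^q = |u|^p`. Moving the
  -- operator onto `g` and using the `L^q` bound gives `X ≤ C ‖f‖_p X^(1/q)`.
  set g : ℝ → ℝ := fun x => |u x| ^ (p - 2) * u x with hg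
  have hgc : Continuous g := (huc.abs.rpow_const fun x => Or.inr (by linarith)).mul huc
  have hgs : HasCompactSupport g := hus.mul_left
  have hug : ∀ x, u x * g x = |u x| ^ p := fun x => by
    rcases eq_or_ne (u x) 0 with h0 | h0
    · simp [h0, Real.zero_rpow (by linarith : p ≠ 0)]
    · have : u x * g x = |u x| ^ (p - 2) * |u x| * |u x| := by
        rw [mul_assoc, abs_mul_abs_self]; simp only [hg]; ring
      rw [this, ← Real.rpow_add_one (abs_pos.2 h0).ne', ← Real.rpow_add_one (abs_pos.2 h0).ne']
      congr 1; ring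
  have hgq : ∀ x, ‖g x‖ₑ ^ q = ‖u x‖ₑ ^ p := fun x => by
    have e : |g x| = |u x| ^ (p - 1) := by
      rcases eq_or_ne (u x) 0 with h0 | h0
      · simp [hg, h0, Real.zero_rpow (by linarith : p - 1 ≠ 0)]
      · simp only [hg]
        rw [abs_mul, abs_of_nonneg (by positivity), ← Real.rpow_add_one (abs_pos.2 h0).ne']
        congr 1; ring
    rw [Real.enorm_eq_ofReal_abs, Real.enorm_eq_ofReal_abs, e,
      ENNReal.ofReal_rpow_of_nonneg (by positivity) hpq.symm.nonneg,
      ENNReal.ofReal_rpow_of_nonneg (by positivity) (by linarith), ← Real.rpow_mul (abs_nonneg _),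
      hq, mul_div_cancel₀ _ (by linarith : p - 1 ≠ 0)]
  set X := ∫⁻ x, ‖u x‖ₑ ^ p with hX
  have hp0 : ENNReal.ofReal p ≠ 0 := by simp; linarith
  have hq0 : ENNReal.ofReal q ≠ 0 := by simpa using hpq.symm.pos
  have hup : eLpNorm u (ENNReal.ofReal p) volume = X ^ (1 / p) := by
    rw [eLpNorm_eq_lintegral_rpow_enorm_toReal hp0 ENNReal.ofReal_ne_top,
      ENNReal.toReal_ofReal (by linarith)]
  have hgn : eLpNorm g (ENNReal.ofReal q) volume = X ^ (1 / q) := by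
    rw [eLpNorm_eq_lintegral_rpow_enorm_toReal hq0 ENNReal.ofReal_ne_top,
      ENNReal.toReal_ofReal hpq.symm.nonneg]
    simp only [hgq, hX]
  -- Finiteness permits the final division by `X^(1/q)`; it comes from the compact support of `K`
  -- and `f`.
  have hXt : X ≠ ∞ := by
    have := (huc.memLp_of_hasCompactSupport (p := ENNReal.ofReal p) (μ := volume) hus).2
    rw [hup] at this
    intro h
    rw [h, ENNReal.top_rpow_of_pos (by have := hpq.pos; positivity)] at this
    exact lt_irrefl _ this
  have hmain : X ≤ eLpNorm f (ENNReal.ofReal p) volume * (C * X ^ (1 / q)) := by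
    have h1 : X = ‖∫ x, u x * g x‖ₑ := by
      simp only [hug]
      rw [Real.enorm_of_nonneg (integral_nonneg fun x => by positivity),
        ofReal_integral_eq_lintegral_ofReal]
      · simp only [hX, Real.enorm_eq_ofReal_abs]
        congr 1; ext x
        rw [ENNReal.ofReal_rpow_of_nonneg (abs_nonneg _) (by linarith)]
      · simp only [← hug]
        exact (huc.mul hgc).integrable_of_hasCompactSupport hus.mul_right
      · exact ae_of_all _ fun x => by positivity
    rw [← hgn, h1, hu, integral_convolution_mul_eq hK.integrable hKe hf hfc hgc hgs]
    refine (enorm_integral_le_lintegral_enorm _).trans ?_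
    have h2 := ENNReal.lintegral_mul_le_Lp_mul_Lq volume hpq (f := fun x => ‖f x‖ₑ)
      (g := fun x => ‖(K ⋆[lsmul ℝ ℝ] g) x‖ₑ) (by fun_prop)
      (measurable_convolution_real hK.measurable hgc.measurable).enorm.aemeasurable
    have h3 := h K hK g hgc hgs
    rw [eLpNorm_eq_lintegral_rpow_enorm_toReal hq0 ENNReal.ofReal_ne_top,
      ENNReal.toReal_ofReal hpq.symm.nonneg] at h3
    rw [eLpNorm_eq_lintegral_rpow_enorm_toReal hp0 ENNReal.ofReal_ne_top,
      ENNReal.toReal_ofReal (by linarith)]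
    simp only [enorm_mul]
    exact h2.trans (by gcongr)
  rw [hup]
  rcases eq_or_ne X 0 with h0 | h0
  · rw [h0, ENNReal.zero_rpow_of_pos (by have := hpq.pos; positivity)]
    exact zero_le
  have hY0 : X ^ (1 / q) ≠ 0 := by simp [h0, hXt]
  have hYt : X ^ (1 / q) ≠ ∞ := ENNReal.rpow_ne_top_of_nonneg
    (by have := hpq.symm.pos; positivity) hXt
  have hXX : X = X ^ (1 / p) * X ^ (1 / q) := by
    rw [← ENNReal.rpow_add _ _ h0 hXt, one_div, one_div, hpq.inv_add_inv_eq_one, ENNReal.rpow_one]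
  rw [← ENNReal.mul_le_mul_iff_left hY0 hYt, ← hXX]
  exact hmain.trans (le_of_eq (by ring))

/-- The Calderón–Zygmund theorem for even compactly supported kernels on the line: uniform `L^p`
bounds for all `1 < p < ∞`. -/
theorem exists_eLpNorm_convolution_le {A B : ℝ≥0∞} (hA : A ≠ ∞) (hB : B ≠ ∞) {p : ℝ≥0∞}
    (hp : 1 < p) (hpt : p < ∞) :
    ∃ C : ℝ≥0∞, C ≠ ∞ ∧ ∀ K, IsHormanderKernel K A B → (∀ x, K (-x) = K x) →
      HasCompactSupport K → ∀ f : ℝ → ℂ, Continuous f → HasCompactSupport f →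
      eLpNorm (K ⋆[lsmul ℝ ℝ] f) p volume ≤ C * eLpNorm f p volume := by
  have hreal : ∃ C : ℝ≥0∞, C ≠ ∞ ∧ ∀ K, IsHormanderKernel K A B → (∀ x, K (-x) = K x) →
      HasCompactSupport K → ∀ f : ℝ → ℝ, Continuous f → HasCompactSupport f →
      eLpNorm (K ⋆[lsmul ℝ ℝ] f) p volume ≤ C * eLpNorm f p volume := by
    have hp1 : 1 < p.toReal := by
      rwa [← ENNReal.toReal_one, ENNReal.toReal_lt_toReal ENNReal.one_ne_top hpt.ne]
    rw [← ENNReal.ofReal_toReal hpt.ne]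
    rcases le_or_gt p.toReal 2 with h2 | h2
    · obtain ⟨C, hC, h⟩ := exists_eLpNorm_convolution_le_of_le_two hA hB hp1 h2
      exact ⟨C, hC, fun K hK _ _ => h K hK⟩
    · exact exists_eLpNorm_convolution_le_of_two_lt hA hB h2
  obtain ⟨C, hC, h⟩ := hreal
  refine ⟨C * 2, by finiteness, fun K hK hKe hKc f hf hfc => ?_⟩
  have hre : Continuous fun x => (f x).re := by fun_prop
  have him : Continuous fun x => (f x).im := by fun_prop
  have hrec : HasCompactSupport fun x => (f x).re := hfc.comp_left (g := Complex.re) rfl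
  have himc : HasCompactSupport fun x => (f x).im := hfc.comp_left (g := Complex.im) rfl
  have hint : ∀ x, Integrable fun t => K (x - t) • f t := fun x => by
    obtain ⟨M, hM⟩ := hfc.exists_bound_of_continuous hf
    exact (hK.integrable.comp_sub_left x).smul_bdd M hf.aestronglyMeasurable (ae_of_all _ hM)
  have hdec : K ⋆[lsmul ℝ ℝ] f = (fun x => ((K ⋆[lsmul ℝ ℝ] fun x => (f x).re) x : ℂ)) +
      fun x => ((K ⋆[lsmul ℝ ℝ] fun x => (f x).im) x : ℂ) * Complex.I := by
    ext x
    simp only [Pi.add_apply, convolution_lsmul_swap]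
    rw [← Complex.re_add_im (∫ t, K (x - t) • f t)]
    congr 2
    · rw [← Complex.reCLM_apply, ← ContinuousLinearMap.integral_comp_comm _ (hint x)]
      simp
    · rw [← Complex.imCLM_apply, ← ContinuousLinearMap.integral_comp_comm _ (hint x)]
      simp
  have hm1 := measurable_convolution_real hK.measurable hre.measurable
  have hm2 := measurable_convolution_real hK.measurable him.measurable
  rw [hdec]
  refine (eLpNorm_add_le (by fun_prop) (by fun_prop) hp.le).trans ?_
  have e1 : eLpNorm (fun x => ((K ⋆[lsmul ℝ ℝ] fun x => (f x).re) x : ℂ)) p volume ≤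
      C * eLpNorm f p volume := by
    rw [eLpNorm_congr_norm_ae (g := K ⋆[lsmul ℝ ℝ] fun x => (f x).re) (ae_of_all _ (by simp))]
    refine (h K hK hKe hKc _ hre hrec).trans ?_
    gcongr
    exact eLpNorm_mono fun x => Complex.abs_re_le_norm _
  have e2 : eLpNorm (fun x => ((K ⋆[lsmul ℝ ℝ] fun x => (f x).im) x : ℂ) * Complex.I) p volume ≤
      C * eLpNorm f p volume := by
    rw [eLpNorm_congr_norm_ae (g := K ⋆[lsmul ℝ ℝ] fun x => (f x).im) (ae_of_all _ (by simp))]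
    refine (h K hK hKe hKc _ him himc).trans ?_
    gcongr
    exact eLpNorm_mono fun x => Complex.abs_im_le_norm _
  exact (add_le_add e1 e2).trans (le_of_eq (by ring))

/-! ### Convolution on `L^p`: Young's inequality and density. -/

section ConvolutionLp

variable {E : Type*} [NormedAddCommGroup E] [NormedSpace ℝ E]

theorem convolutionExists_of_bounded_hasCompactSupport {K : ℝ → ℝ} {f : ℝ → E} (hK : Measurable K)
    {M : ℝ} (hM : ∀ x, |K x| ≤ M) (hKc : HasCompactSupport K) (hf : LocallyIntegrable f) :
    ConvolutionExists K f (lsmul ℝ ℝ) volume := by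
  intro x
  have hcomp : IntegrableOn (fun t => f (x - t)) (tsupport K) := by
    have h1 : IntegrableOn f ((fun t => x - t) '' tsupport K) :=
      hf.integrableOn_isCompact (hKc.isCompact.image (by fun_prop))
    have h2 := (Measure.measurePreserving_sub_left volume x).integrableOn_image
      (MeasurableEquiv.subLeft x).measurableEmbedding (f := f) (s := tsupport K)
    exact h2.1 h1
  refine (integrableOn_iff_integrable_of_support_subset (s := tsupport K) ?_).1
    (Integrable.bdd_smul hcomp M hK.aestronglyMeasurable (ae_of_all _ hM))
  intro t ht
  refine subset_tsupport _ fun h => ht ?_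
  simp [h]

theorem aestronglyMeasurable_convolution {K : ℝ → ℝ} {f : ℝ → E} (hK : AEStronglyMeasurable K)
    (hf : AEStronglyMeasurable f) :
    AEStronglyMeasurable (K ⋆[lsmul ℝ ℝ] f) :=
  (hK.convolution_integrand (lsmul ℝ ℝ) hf).integral_prod_right'

/-- Young's inequality for an integrable kernel acting on `L^p`. -/
theorem eLpNorm_convolution_le {K : ℝ → ℝ} {f : ℝ → E} {p : ℝ≥0∞} (hp : 1 ≤ p) (hpt : p ≠ ∞)
    (hK : Integrable K) (hKm : Measurable K) (hf : AEStronglyMeasurable f) :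
    eLpNorm (K ⋆[lsmul ℝ ℝ] f) p volume ≤ (∫⁻ x, ‖K x‖ₑ) * eLpNorm f p volume := by
  obtain ⟨g, hg, hfg⟩ := hf
  rw [convolution_congr (lsmul ℝ ℝ) (EventuallyEq.refl _ K) hfg, eLpNorm_congr_ae hfg]
  set k := ∫⁻ x, ‖K x‖ₑ with hk
  have hkt : k ≠ ∞ := hK.2.ne
  have hs : 1 ≤ p.toReal := by
    rwa [← ENNReal.toReal_one, ENNReal.toReal_le_toReal ENNReal.one_ne_top hpt]
  have hs0 : 0 < p.toReal := by linarith
  have hp0 : p ≠ 0 := (zero_lt_one.trans_le hp).ne'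
  -- The convolution is dominated by an `L¹` norm for `|K| dt`, of total mass `k`; comparison of
  -- `L¹` with `L^p` on this finite measure leaves the factor `k^(p-1)`, and Tonelli supplies the
  -- last `k`.
  set ν := (volume : Measure ℝ).withDensity fun t => ‖K t‖ₑ with hν
  have hνu : ν Set.univ = k := by simp [hν, hk]
  have hpt' : ∀ x, ‖(K ⋆[lsmul ℝ ℝ] g) x‖ₑ ^ p.toReal ≤
      k ^ (p.toReal - 1) * ∫⁻ t, ‖K t‖ₑ * ‖g (x - t)‖ₑ ^ p.toReal := by
    intro x
    have h1 : ‖(K ⋆[lsmul ℝ ℝ] g) x‖ₑ ≤ eLpNorm (fun t => g (x - t)) 1 ν := by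
      rw [eLpNorm_one_eq_lintegral_enorm, hν, lintegral_withDensity_eq_lintegral_mul _
        hKm.enorm (by fun_prop)]
      refine (enorm_integral_le_lintegral_enorm _).trans (le_of_eq ?_)
      simp [enorm_smul]
    have h2 := eLpNorm_le_eLpNorm_mul_rpow_measure_univ (μ := ν) (f := fun t => g (x - t)) hp
      (hg.comp_measurable (by fun_prop)).aestronglyMeasurable
    rw [eLpNorm_eq_lintegral_rpow_enorm_toReal hp0 hpt, hνu, hν,
      lintegral_withDensity_eq_lintegral_mul _ hKm.enorm (by fun_prop)] at h2
    refine (ENNReal.rpow_le_rpow (h1.trans h2) hs0.le).trans (le_of_eq ?_)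
    rw [ENNReal.mul_rpow_of_nonneg _ _ hs0.le, ← ENNReal.rpow_mul, ← ENNReal.rpow_mul,
      one_div_mul_cancel hs0.ne', ENNReal.rpow_one, mul_comm, ENNReal.toReal_one,
      show (1 / 1 - 1 / p.toReal) * p.toReal = p.toReal - 1 by field_simp]
    rfl
  rw [eLpNorm_eq_lintegral_rpow_enorm_toReal hp0 hpt,
    eLpNorm_eq_lintegral_rpow_enorm_toReal hp0 hpt]
  have hmain : ∫⁻ x, ‖(K ⋆[lsmul ℝ ℝ] g) x‖ₑ ^ p.toReal ≤
      k ^ p.toReal * ∫⁻ x, ‖g x‖ₑ ^ p.toReal := by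
    calc _ ≤ ∫⁻ x, k ^ (p.toReal - 1) * ∫⁻ t, ‖K t‖ₑ * ‖g (x - t)‖ₑ ^ p.toReal :=
          lintegral_mono hpt'
      _ = k ^ (p.toReal - 1) * ∫⁻ t, ∫⁻ x, ‖K t‖ₑ * ‖g (x - t)‖ₑ ^ p.toReal := by
          have hm : Measurable (Function.uncurry fun x t => ‖K t‖ₑ * ‖g (x - t)‖ₑ ^ p.toReal) := by
            fun_prop
          have hm' : Measurable fun x => ∫⁻ t, ‖K t‖ₑ * ‖g (x - t)‖ₑ ^ p.toReal :=
            hm.lintegral_prod_right'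
          rw [lintegral_const_mul _ hm',
            lintegral_lintegral_swap hm.aemeasurable]
      _ = k ^ (p.toReal - 1) * (k * ∫⁻ x, ‖g x‖ₑ ^ p.toReal) := by
          rw [hk, ← lintegral_mul_const _ hKm.enorm]
          congr 2
          ext t
          rw [lintegral_const_mul _ (by fun_prop),
            lintegral_sub_right_eq_self (fun x => ‖g x‖ₑ ^ p.toReal)]
      _ = _ := by
          rw [← mul_assoc]
          congr 1
          nth_rw 2 [← ENNReal.rpow_one k]
          rw [← ENNReal.rpow_add_of_nonneg _ _ (by linarith) zero_le_one, sub_add_cancel]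
  refine (ENNReal.rpow_le_rpow hmain (by positivity)).trans (le_of_eq ?_)
  rw [ENNReal.mul_rpow_of_nonneg _ _ (by positivity), ← ENNReal.rpow_mul,
    mul_one_div_cancel hs0.ne', ENNReal.rpow_one]

/-- An `L^p` bound for a convolution operator on test functions extends to all of `L^p`. -/
theorem eLpNorm_convolution_le_of_contDiff [FiniteDimensional ℝ E]
    {K : ℝ → ℝ} {p C : ℝ≥0∞} (hp : 1 ≤ p)
    (hpt : p ≠ ∞) (hC : C ≠ ∞) (hK : Measurable K) {M : ℝ} (hM : ∀ x, |K x| ≤ M)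
    (hKc : HasCompactSupport K) (hKi : Integrable K)
    (h : ∀ g : ℝ → E, HasCompactSupport g → ContDiff ℝ (⊤ : ℕ∞) g →
      eLpNorm (K ⋆[lsmul ℝ ℝ] g) p volume ≤ C * eLpNorm g p volume)
    {f : ℝ → E} (hf : MemLp f p) :
    eLpNorm (K ⋆[lsmul ℝ ℝ] f) p volume ≤ C * eLpNorm f p volume := by
  set k := ∫⁻ x, ‖K x‖ₑ
  have hkt : k ≠ ∞ := hKi.2.ne
  -- The error `f - g` is controlled by Young's inequality. Its constant `k` depends on `K`, but is
  -- multiplied by `η → 0` and leaves `C` unchanged.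
  have key : ∀ η : ℝ, 0 < η → eLpNorm (K ⋆[lsmul ℝ ℝ] f) p volume ≤
      C * (eLpNorm f p volume + ENNReal.ofReal η) + k * ENNReal.ofReal η := by
    intro η hη
    obtain ⟨g, hgc, hgs, hfg⟩ := hf.exist_eLpNorm_sub_le hpt hp hη
    have hg : MemLp g p := hgs.continuous.memLp_of_hasCompactSupport hgc
    have hdec : K ⋆[lsmul ℝ ℝ] f = K ⋆[lsmul ℝ ℝ] g + K ⋆[lsmul ℝ ℝ] (f - g) := by
      rw [← ConvolutionExists.distrib_add
        (convolutionExists_of_bounded_hasCompactSupport hK hM hKc (hg.locallyIntegrable hp))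
        (convolutionExists_of_bounded_hasCompactSupport hK hM hKc
          ((hf.sub hg).locallyIntegrable hp)), add_sub_cancel]
    rw [hdec]
    refine (eLpNorm_add_le
      (aestronglyMeasurable_convolution hK.aestronglyMeasurable hg.aestronglyMeasurable)
      (aestronglyMeasurable_convolution hK.aestronglyMeasurable (hf.sub hg).aestronglyMeasurable)
      hp).trans (add_le_add ((h g hgc hgs).trans ?_)
      ((eLpNorm_convolution_le hp hpt hKi hK (hf.sub hg).aestronglyMeasurable).trans ?_))
    · gcongr
      have : g = f - (f - g) := by simp
      rw [this]
      exact (eLpNorm_sub_le hf.aestronglyMeasurable (hf.sub hg).aestronglyMeasurable hp).trans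
        (by gcongr)
    · gcongr
  have hlim : Tendsto (fun η : ℝ => C * (eLpNorm f p volume + ENNReal.ofReal η) +
      k * ENNReal.ofReal η) (𝓝[>] 0) (𝓝 (C * (eLpNorm f p volume + 0) + k * 0)) := by
    have h0 : Tendsto (fun η : ℝ => ENNReal.ofReal η) (𝓝[>] 0) (𝓝 0) := by
      have := (ENNReal.continuous_ofReal.tendsto 0).mono_left (nhdsWithin_le_nhds (s := Set.Ioi 0))
      rwa [ENNReal.ofReal_zero] at this
    exact (ENNReal.Tendsto.const_mul (tendsto_const_nhds.add h0) (Or.inr hC)).add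
      (ENNReal.Tendsto.const_mul h0 (Or.inr hkt))
  rw [add_zero, mul_zero, add_zero] at hlim
  refine ge_of_tendsto hlim ?_
  filter_upwards [self_mem_nhdsWithin] with η hη using key η hη

end ConvolutionLp

/-! ### The box kernel and its regularity. -/

/-- The kernel of the averaging operator `lineD e`. -/
noncomputable def boxKernel (e : ℝ) : ℝ → ℝ := (Set.Icc (-e) e).indicator fun _ => 1 / (2 * e)

theorem measurable_boxKernel (e : ℝ) : Measurable (boxKernel e) :=
  measurable_const.indicator measurableSet_Icc

theorem abs_boxKernel_le (e x : ℝ) : |boxKernel e x| ≤ |1 / (2 * e)| := by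
  unfold boxKernel
  exact Set.indicator_rel_indicator (r := fun a b => |a| ≤ |1 / (2 * e)|) (by simp) (by simp)
    (s := Set.Icc (-e) e) (a := x) (f := fun _ => 1 / (2 * e)) (g := fun _ => 1 / (2 * e))

theorem hasCompactSupport_boxKernel (e : ℝ) : HasCompactSupport (boxKernel e) :=
  HasCompactSupport.intro isCompact_Icc fun _ hx => Set.indicator_of_notMem hx _

theorem integrable_boxKernel (e : ℝ) : Integrable (boxKernel e) :=
  (integrable_indicator_iff measurableSet_Icc).2 (integrableOn_const (by simp))

theorem boxKernel_neg (e x : ℝ) : boxKernel e (-x) = boxKernel e x := by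
  simp only [boxKernel, Set.indicator, Set.mem_Icc]
  congr 1
  rw [neg_le_neg_iff, neg_le, and_comm]

theorem lineD_eq_convolution {e : ℝ} (he : 0 < e) (f : ℝ → ℂ) :
    lineD e f = boxKernel e ⋆[lsmul ℝ ℝ] f := by
  ext x
  rw [lineD, intervalIntegral.integral_of_le (by linarith), ← integral_Icc_eq_integral_Ioc,
    ← integral_const_mul, ← integral_indicator measurableSet_Icc]
  refine integral_congr_ae (ae_of_all _ fun t => ?_)
  by_cases ht : t ∈ Set.Icc (-e) e
  · simp [boxKernel, ht]
  · simp [boxKernel, ht]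

/-- Hörmander's condition for a single average. -/
theorem setLIntegral_boxKernel_sub_le {e h y : ℝ} (he : 0 < e) (hy : |y| ≤ h) :
    ∫⁻ x in {x | 2 * h < |x|}, ‖boxKernel e (x - y) - boxKernel e x‖ₑ ≤
      ENNReal.ofReal (2 * if h ≤ e then h / e else 0) := by
  have hm : MeasurableSet {x : ℝ | 2 * h < |x|} :=
    measurableSet_lt measurable_const measurable_norm
  split_ifs with hhe
  -- A shift by at most `h` changes the indicator only within `h` of `±e`: a set of measure at most
  -- `4h`, where the kernel has height `1 / (2e)`.
  · set V := Metric.closedBall e h ∪ Metric.closedBall (-e) h with hV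
    have hh : 0 ≤ h := (abs_nonneg y).trans hy
    have hpt : ∀ x, ‖boxKernel e (x - y) - boxKernel e x‖ₑ ≤
        V.indicator (fun _ => ENNReal.ofReal (1 / (2 * e))) x := by
      intro x
      by_cases hx : x ∈ V
      · rw [Set.indicator_of_mem hx, Real.enorm_eq_ofReal_abs]
        refine ENNReal.ofReal_le_ofReal ?_
        simp only [boxKernel, Set.indicator]
        split_ifs <;> simp [abs_of_pos he, he.le]
      · rw [Set.indicator_of_notMem hx, nonpos_iff_eq_zero, enorm_eq_zero, sub_eq_zero]
        simp only [hV, Set.mem_union, Metric.mem_closedBall, Real.dist_eq, not_or, not_le] at hx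
        simp only [boxKernel, Set.indicator, Set.mem_Icc]
        congr 1
        rw [abs_le] at hy
        rw [lt_abs, lt_abs] at hx
        simp only [eq_iff_iff]
        constructor
        · rintro ⟨h1, h2⟩
          constructor
          · rcases hx.2 with h | h <;> linarith
          · rcases hx.1 with h | h <;> linarith
        · rintro ⟨h1, h2⟩
          constructor
          · rcases hx.2 with h | h <;> linarith
          · rcases hx.1 with h | h <;> linarith
    calc _ ≤ ∫⁻ x, V.indicator (fun _ => ENNReal.ofReal (1 / (2 * e))) x :=
          (setLIntegral_le_lintegral _ _).trans (lintegral_mono hpt)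
      _ = ENNReal.ofReal (1 / (2 * e)) * volume V := by
          rw [lintegral_indicator_const (measurableSet_closedBall.union measurableSet_closedBall)]
      _ ≤ ENNReal.ofReal (1 / (2 * e)) * (ENNReal.ofReal (2 * h) + ENNReal.ofReal (2 * h)) := by
          gcongr
          refine (measure_union_le _ _).trans (le_of_eq ?_)
          rw [Real.volume_closedBall, Real.volume_closedBall]
      _ = _ := by
          rw [← ENNReal.ofReal_add (by positivity) (by positivity),
            ← ENNReal.ofReal_mul (by positivity)]
          congr 1
          field_simp
          ring
  -- When `e < h`, both `x` and `x - y` lie outside the support of the kernel.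
  · rw [setLIntegral_congr_fun (g := fun _ => 0) hm]
    · simp
    · intro x hx
      have hx : 2 * h < |x| := hx
      have h1 : h < |x - y| := by linarith [abs_sub_abs_le_abs_sub x y]
      have n1 : x ∉ Set.Icc (-e) e := fun h' => by
        have := abs_le.2 h'; linarith [abs_nonneg y]
      have n2 : x - y ∉ Set.Icc (-e) e := fun h' => by
        have := abs_le.2 h'; linarith
      simp only [boxKernel]
      rw [Set.indicator_of_notMem n1, Set.indicator_of_notMem n2]
      simp

/-! ### Geometric sums over scales and the Fourier multiplier. -/

section Lacunary

variable {r : ℝ} {ε : ℕ → ℝ}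

theorem lacunary_ratio_pos (hpos : ∀ k, 0 < ε k) (hε : ∀ k, ε (k + 1) ≤ r * ε k) : 0 < r :=
  pos_of_mul_pos_left ((hpos 1).trans_le (hε 0)) (hpos 0).le

/-- The nonzero terms grow at least geometrically with `k` and the last is at most `1`. The
induction keeps the sharper bound by the last term divided by `1 - r`. -/
theorem sum_large_scales_le (hr : r < 1) (hpos : ∀ k, 0 < ε k) (hε : ∀ k, ε (k + 1) ≤ r * ε k)
    {h : ℝ} (hh : 0 < h) (n : ℕ) :
    ∑ k ∈ Finset.range n, (if h ≤ ε k then h / ε k else 0) ≤ 1 / (1 - r) := by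
  have hr0 := lacunary_ratio_pos hpos hε
  have h1r : 0 < 1 - r := by linarith
  have hmono : ∀ n, ε (n + 1) ≤ ε n := fun n => (hε n).trans (by nlinarith [hpos n])
  have key : ∀ n, h ≤ ε n →
      ∑ k ∈ Finset.range (n + 1), (if h ≤ ε k then h / ε k else 0) ≤ h / ε n / (1 - r) := by
    intro n
    induction n with
    | zero =>
      intro h0
      have : 0 < h / ε 0 := div_pos hh (hpos 0)
      simp only [zero_add, Finset.sum_range_one, if_pos h0]
      rw [le_div_iff₀ h1r]
      nlinarith
    | succ n ih =>
      intro hn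
      rw [Finset.sum_range_succ, if_pos hn]
      have h1 := ih (hn.trans (hmono n))
      have h2 : h / ε n ≤ r * (h / ε (n + 1)) := by
        rw [mul_div_assoc', div_le_div_iff₀ (hpos n) (hpos (n + 1))]
        nlinarith [hε n]
      have h3 : h / ε n / (1 - r) ≤ r * (h / ε (n + 1)) / (1 - r) := by gcongr
      have h4 : r * (h / ε (n + 1)) / (1 - r) + h / ε (n + 1) = h / ε (n + 1) / (1 - r) := by
        field_simp
        ring
      linarith
  induction n with
  | zero => simp; linarith
  | succ n ih =>
    by_cases hn : h ≤ ε n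
    · refine (key n hn).trans ?_
      gcongr
      exact (div_le_one (hpos n)).2 hn
    · rw [Finset.sum_range_succ, if_neg hn, add_zero]
      exact ih

/-- The nonzero terms start at most at `1` and decay geometrically. The induction carries `min (ε n)
h / h / (1 - r)`, a bound for everything still to come. -/
theorem sum_small_scales_le (hr : r < 1) (hpos : ∀ k, 0 < ε k) (hε : ∀ k, ε (k + 1) ≤ r * ε k)
    {h : ℝ} (hh : 0 < h) (n : ℕ) :
    ∑ k ∈ Finset.range n, (if ε k < h then ε k / h else 0) ≤ 1 / (1 - r) := by
  have h1r : 0 < 1 - r := by linarith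
  have key : ∑ k ∈ Finset.range n, (if ε k < h then ε k / h else 0) +
      min (ε n) h / h / (1 - r) ≤ 1 / (1 - r) := by
    induction n with
    | zero =>
      rw [Finset.sum_range_zero, zero_add]
      gcongr
      exact (div_le_one hh).2 (min_le_right _ _)
    | succ n ih =>
      refine le_trans ?_ ih
      rw [Finset.sum_range_succ, add_assoc]
      gcongr
      split_ifs with hn
      · rw [min_eq_left hn.le]
        have h1 : min (ε (n + 1)) h / h / (1 - r) ≤ r * ε n / h / (1 - r) := by
          gcongr
          exact (min_le_left _ _).trans (hε n)
        have h2 : ε n / h + r * ε n / h / (1 - r) = ε n / h / (1 - r) := by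
          field_simp
          ring
        linarith
      · rw [min_eq_right (not_lt.1 hn), zero_add]
        gcongr
        exact min_le_right _ _
  have : 0 ≤ min (ε n) h / h / (1 - r) := by
    have := hpos n
    positivity
  linarith

theorem Real.abs_sinc_sub_one_le {x : ℝ} (hx : |x| ≤ 1) : |Real.sinc x - 1| ≤ |x| := by
  wlog h0 : 0 ≤ x generalizing x
  · simpa using this (x := -x) (by simpa using hx) (by linarith)
  rcases h0.eq_or_lt with rfl | h0
  · simp
  rw [abs_of_pos h0] at hx ⊢
  have h1 : 1 - x ^ 2 / 4 < Real.sinc x := by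
    rw [Real.sinc_of_ne_zero h0.ne', lt_div_iff₀ h0]
    nlinarith [Real.sin_gt_sub_cube h0, pow_pos h0 3]
  have h2 := Real.sinc_le_one x
  rw [abs_of_nonpos (by linarith)]
  nlinarith

theorem Real.abs_sinc_le_inv {x : ℝ} (hx : 0 < x) : |Real.sinc x| ≤ 1 / x := by
  rw [Real.sinc_of_ne_zero hx.ne', abs_div, abs_of_pos hx]
  gcongr
  exact Real.abs_sin_le_one x

/-- The multiplier of a partial sum is bounded, uniformly in the frequency. -/
theorem abs_sum_sinc_sub_le (hr : r < 1) (hpos : ∀ k, 0 < ε k) (hε : ∀ k, ε (k + 1) ≤ r * ε k)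
    (F : Finset ℕ) (ω : ℝ) :
    |∑ k ∈ F, (Real.sinc (ω * ε (k + 1)) - Real.sinc (ω * ε k))| ≤ 4 / (1 - r) + 1 := by
  have h1r : 0 < 1 - r := by linarith
  wlog hω : 0 ≤ ω generalizing ω
  · have := this (-ω) (by linarith)
    simpa [neg_mul] using this
  rcases hω.eq_or_lt with rfl | hω
  · simp; positivity
  have hr0 := lacunary_ratio_pos hpos hε
  have hmono : ∀ n, ε (n + 1) ≤ ε n := fun n => (hε n).trans (by nlinarith [hpos n])
  -- At the critical scale `1/ω`, compare `sinc (ω ε k)` with the step `t k`, with error `a k`. The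
  -- errors enter twice, each total at most `2 / (1 - r)`, and the monotone steps telescope to at
  -- most `1`.
  set h := 1 / ω with hh
  have hh0 : 0 < h := by positivity
  set t : ℕ → ℝ := fun k => if ε k < h then 1 else 0 with ht
  set a : ℕ → ℝ := fun k => (if h ≤ ε k then h / ε k else 0) + if ε k < h then ε k / h else 0
  have ha : ∀ k, |Real.sinc (ω * ε k) - t k| ≤ a k := by
    intro k
    have hk := mul_pos hω (hpos k)
    by_cases hkh : ε k < h
    · simp only [ht, a, if_pos hkh, if_neg (not_le.2 hkh), zero_add]
      have e : ω * ε k = ε k / h := by rw [hh]; field_simp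
      refine (Real.abs_sinc_sub_one_le ?_).trans (by rw [abs_of_pos hk, e])
      rw [abs_of_pos hk, e]
      exact (div_le_one hh0).2 hkh.le
    · simp only [ht, a, if_neg hkh, if_pos (not_lt.1 hkh), add_zero, sub_zero]
      refine (Real.abs_sinc_le_inv hk).trans (le_of_eq ?_)
      rw [hh]; field_simp
  have ha0 : ∀ k, 0 ≤ a k := fun k => (abs_nonneg _).trans (ha k)
  have htm : ∀ k, t k ≤ t (k + 1) := fun k => by
    simp only [ht]
    split_ifs with h1 h2
    · exact le_rfl
    · exact absurd ((hmono k).trans_lt h1) h2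
    · exact zero_le_one
    · exact le_rfl
  have hasum : ∀ n, ∑ k ∈ Finset.range n, a k ≤ 2 / (1 - r) := fun n => by
    rw [Finset.sum_add_distrib]
    have := sum_large_scales_le hr hpos hε hh0 n
    have := sum_small_scales_le hr hpos hε hh0 n
    have : 2 / (1 - r) = 1 / (1 - r) + 1 / (1 - r) := by ring
    linarith
  obtain ⟨n, hn⟩ := F.exists_nat_subset_range
  have hterm : ∀ k, |Real.sinc (ω * ε (k + 1)) - Real.sinc (ω * ε k)| ≤
      a (k + 1) + a k + (t (k + 1) - t k) := fun k => by
    have h1 := ha (k + 1)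
    have h2 := ha k
    have h3 := htm k
    rw [abs_le] at *
    constructor <;> linarith [h1.1, h1.2, h2.1, h2.2]
  calc _ ≤ ∑ k ∈ F, (a (k + 1) + a k + (t (k + 1) - t k)) :=
        (Finset.abs_sum_le_sum_abs _ _).trans (Finset.sum_le_sum fun k _ => hterm k)
    _ ≤ ∑ k ∈ Finset.range n, (a (k + 1) + a k + (t (k + 1) - t k)) :=
        Finset.sum_le_sum_of_subset_of_nonneg hn fun k _ _ => (abs_nonneg _).trans (hterm k)
    _ = (∑ k ∈ Finset.range (n + 1), a k - a 0) + ∑ k ∈ Finset.range n, a k + (t n - t 0) := by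
        rw [Finset.sum_add_distrib, Finset.sum_add_distrib, Finset.sum_range_sub,
          Finset.sum_range_succ' a n, add_sub_cancel_right]
    _ ≤ _ := by
        have h1 := hasum (n + 1)
        have h2 := hasum n
        have h3 : t n ≤ 1 := by simp only [ht]; split_ifs <;> norm_num
        have h4 : 0 ≤ t 0 := by simp only [ht]; split_ifs <;> norm_num
        have : 4 / (1 - r) = 2 / (1 - r) + 2 / (1 - r) := by ring
        linarith [ha0 0]

end Lacunary

/-! ### Kernels of the partial sums: `L²` bound, Hörmander's condition, uniform `L^p` bound. -/

theorem fourier_boxKernel {e : ℝ} (he : 0 < e) (ξ : ℝ) :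
    𝓕 (fun x => (boxKernel e x : ℂ)) ξ = Real.sinc (2 * π * ξ * e) := by
  rw [Real.fourier_real_eq_integral_exp_smul]
  have h1 : ∀ v : ℝ, Complex.exp (↑(-2 * π * v * ξ) * Complex.I) • (boxKernel e v : ℂ) =
      (Set.Icc (-e) e).indicator (fun v : ℝ => (1 / (2 * e) : ℂ) *
        Complex.exp (((-2 * π * ξ * v : ℝ) : ℂ) * Complex.I)) v := fun v => by
    by_cases hv : v ∈ Set.Icc (-e) e
    · rw [boxKernel, Set.indicator_of_mem hv, Set.indicator_of_mem hv, smul_eq_mul, mul_comm]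
      push_cast
      ring_nf
    · rw [boxKernel, Set.indicator_of_notMem hv, Set.indicator_of_notMem hv]
      simp
  simp only [h1]
  rw [integral_indicator measurableSet_Icc, integral_Icc_eq_integral_Ioc,
    ← intervalIntegral.integral_of_le (by linarith), intervalIntegral.integral_const_mul]
  have heC : (e : ℂ) ≠ 0 := by exact_mod_cast he.ne'
  rcases eq_or_ne ξ 0 with rfl | hξ
  · simp
    field_simp
    norm_num
  · have hc : -2 * π * ξ ≠ 0 := by positivity
    rw [intervalIntegral.integral_comp_mul_left (fun t : ℝ => Complex.exp ((t : ℂ) * Complex.I)) hc,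
      mul_neg, integral_exp_mul_I_eq_sinc, ← Real.sinc_neg (2 * π * ξ * e),
      show -(2 * π * ξ * e) = -2 * π * ξ * e by ring, Complex.real_smul]
    generalize -2 * π * ξ = c at hc
    have hcC : (c : ℂ) ≠ 0 := by exact_mod_cast hc
    push_cast
    field_simp

/-- The kernel of a finite partial sum of the series of differences of averages. -/
noncomputable def differenceKernel (ε : ℕ → ℝ) (F : Finset ℕ) (x : ℝ) : ℝ :=
  ∑ k ∈ F, (boxKernel (ε (k + 1)) x - boxKernel (ε k) x)

section DifferenceKernel

variable (ε : ℕ → ℝ) (F : Finset ℕ)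

theorem measurable_differenceKernel : Measurable (differenceKernel ε F) :=
  Finset.measurable_fun_sum _ fun _ _ => (measurable_boxKernel _).sub (measurable_boxKernel _)

theorem integrable_differenceKernel : Integrable (differenceKernel ε F) :=
  integrable_finsetSum _ fun _ _ => (integrable_boxKernel _).sub (integrable_boxKernel _)

theorem exists_abs_differenceKernel_le : ∃ M, ∀ x, |differenceKernel ε F x| ≤ M :=
  ⟨∑ k ∈ F, (|1 / (2 * ε (k + 1))| + |1 / (2 * ε k)|), fun _ =>
    (Finset.abs_sum_le_sum_abs _ _).trans (Finset.sum_le_sum fun _ _ =>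
      (abs_sub _ _).trans (add_le_add (abs_boxKernel_le _ _) (abs_boxKernel_le _ _)))⟩

theorem hasCompactSupport_differenceKernel : HasCompactSupport (differenceKernel ε F) := by
  induction F using Finset.induction_on with
  | empty =>
    have : differenceKernel ε ∅ = 0 := by ext x; simp [differenceKernel]
    rw [this]
    exact HasCompactSupport.zero
  | insert a s ha ih =>
    have : differenceKernel ε (insert a s) =
        (boxKernel (ε (a + 1)) - boxKernel (ε a)) + differenceKernel ε s := by
      ext x; simp [differenceKernel, Finset.sum_insert ha, -Finset.sum_sub_distrib]
    rw [this]
    exact ((hasCompactSupport_boxKernel _).sub (hasCompactSupport_boxKernel _)).add ih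

theorem differenceKernel_neg (x : ℝ) : differenceKernel ε F (-x) = differenceKernel ε F x := by
  simp only [differenceKernel, boxKernel_neg]

variable {ε F}

theorem integrable_lineD_integrand {f : ℝ → ℂ} (hf : LocallyIntegrable f) (e x : ℝ) :
    Integrable fun t => boxKernel e t • f (x - t) :=
  convolutionExists_of_bounded_hasCompactSupport (measurable_boxKernel e) (abs_boxKernel_le e)
    (hasCompactSupport_boxKernel e) hf x

theorem differenceKernel_convolution (hpos : ∀ k, 0 < ε k) {f : ℝ → ℂ}
    (hf : LocallyIntegrable f) :
    differenceKernel ε F ⋆[lsmul ℝ ℝ] f =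
      fun x => ∑ k ∈ F, (lineD (ε (k + 1)) f x - lineD (ε k) f x) := by
  ext x
  simp only [lineD_eq_convolution (hpos _), convolution_lsmul, differenceKernel, Finset.sum_smul,
    sub_smul]
  rw [integral_finsetSum]
  · refine Finset.sum_congr rfl fun k _ => integral_sub ?_ ?_ <;>
    exact integrable_lineD_integrand hf _ _
  · exact fun k _ => (integrable_lineD_integrand hf _ _).sub (integrable_lineD_integrand hf _ _)

theorem fourier_differenceKernel (hpos : ∀ k, 0 < ε k) (ξ : ℝ) :
    𝓕 (fun x => (differenceKernel ε F x : ℂ)) ξ =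
      ((∑ k ∈ F, (Real.sinc (2 * π * ξ * ε (k + 1)) - Real.sinc (2 * π * ξ * ε k)) : ℝ) : ℂ) := by
  have hi : ∀ e, Integrable fun v : ℝ =>
      Complex.exp (↑(-2 * π * v * ξ) * Complex.I) * (boxKernel e v : ℂ) := fun e => by
    refine (integrable_boxKernel e).ofReal.bdd_mul (c := 1) (by fun_prop) (ae_of_all _ fun v => ?_)
    rw [Complex.norm_exp_ofReal_mul_I]
  push_cast
  simp only [← fourier_boxKernel (hpos _), Real.fourier_real_eq_integral_exp_smul,
    differenceKernel, smul_eq_mul]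
  push_cast
  simp only [Finset.mul_sum, mul_sub]
  rw [integral_finsetSum]
  · exact Finset.sum_congr rfl fun k _ => by
      simpa using integral_sub (hi (ε (k + 1))) (hi (ε k))
  · intro k _
    refine ((hi (ε (k + 1))).sub (hi (ε k))).congr (ae_of_all _ fun v => ?_)
    simp

variable {r : ℝ}

/-- Plancherel with the multiplier bound. Smoothness and compact support make both `g` and its
convolution Schwartz functions. -/
theorem integral_sq_differenceKernel_convolution_le (hr : r < 1) (hpos : ∀ k, 0 < ε k)
    (hε : ∀ k, ε (k + 1) ≤ r * ε k) {g : ℝ → ℂ} (hgc : HasCompactSupport g)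
    (hg : ContDiff ℝ (⊤ : ℕ∞) g) :
    ∫ x, ‖(differenceKernel ε F ⋆[lsmul ℝ ℝ] g) x‖ ^ 2 ≤
      (4 / (1 - r) + 1) ^ 2 * ∫ x, ‖g x‖ ^ 2 := by
  set u := differenceKernel ε F ⋆[lsmul ℝ ℝ] g with hu
  have hus : ContDiff ℝ (⊤ : ℕ∞) u := hgc.contDiff_convolution_right (lsmul ℝ ℝ)
    (integrable_differenceKernel ε F).locallyIntegrable hg
  have huc : HasCompactSupport u := (hasCompactSupport_differenceKernel ε F).convolution _ hgc
  have hconv : u = (fun x => (differenceKernel ε F x : ℂ)) ⋆[lsmul ℂ ℂ] g := by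
    ext x
    simp [hu, convolution_lsmul]
  have hKi : Integrable fun x => (differenceKernel ε F x : ℂ) :=
    (integrable_differenceKernel ε F).ofReal
  have hF : ∀ ξ, ‖𝓕 u ξ‖ ^ 2 ≤ (4 / (1 - r) + 1) ^ 2 * ‖𝓕 g ξ‖ ^ 2 := fun ξ => by
    rw [hconv, Real.fourier_smul_convolution_eq hKi
      (hg.continuous.integrable_of_hasCompactSupport hgc), fourier_differenceKernel hpos, norm_smul,
      mul_pow, Complex.norm_real, Real.norm_eq_abs]
    gcongr
    exact abs_sum_sinc_sub_le hr hpos hε F _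
  have h1 := SchwartzMap.integral_norm_sq_fourier (huc.toSchwartzMap hus)
  have h2 := SchwartzMap.integral_norm_sq_fourier (hgc.toSchwartzMap hg)
  have hint : Integrable fun ξ => ‖𝓕 g ξ‖ ^ 2 := by
    have := (𝓕 (hgc.toSchwartzMap hg)).memLp 2 volume
    have := (memLp_two_iff_integrable_sq_norm this.1).1 this
    rwa [SchwartzMap.fourier_coe] at this
  simp only [SchwartzMap.fourier_coe] at h1 h2
  calc _ = ∫ ξ, ‖𝓕 u ξ‖ ^ 2 := h1.symm
    _ ≤ ∫ ξ, (4 / (1 - r) + 1) ^ 2 * ‖𝓕 g ξ‖ ^ 2 :=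
        integral_mono_of_nonneg (ae_of_all _ fun _ => by positivity) (hint.const_mul _)
          (ae_of_all _ hF)
    _ = (4 / (1 - r) + 1) ^ 2 * ∫ ξ, ‖𝓕 g ξ‖ ^ 2 := integral_const_mul _ _
    _ = _ := congrArg _ h2

/-- The extension beyond test functions is needed because the good part in the Calderón–Zygmund
argument is merely measurable, bounded and integrable. -/
theorem eLpNorm_two_differenceKernel_convolution_le (hr : r < 1) (hpos : ∀ k, 0 < ε k)
    (hε : ∀ k, ε (k + 1) ≤ r * ε k) {f : ℝ → ℂ} (hf : MemLp f 2) :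
    eLpNorm (differenceKernel ε F ⋆[lsmul ℝ ℝ] f) 2 volume ≤
      ENNReal.ofReal (4 / (1 - r) + 1) * eLpNorm f 2 volume := by
  obtain ⟨M, hM⟩ := exists_abs_differenceKernel_le ε F
  have hm0 : 0 ≤ 4 / (1 - r) + 1 := by
    have : 0 < 1 - r := by linarith
    positivity
  refine eLpNorm_convolution_le_of_contDiff (by norm_num) (by norm_num) (by finiteness)
    (measurable_differenceKernel ε F) hM
    (hasCompactSupport_differenceKernel ε F) (integrable_differenceKernel ε F)
    (fun g hgc hg => ?_) hf
  have hcont : Continuous (differenceKernel ε F ⋆[lsmul ℝ ℝ] g) :=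
    hgc.continuous_convolution_right _ (integrable_differenceKernel ε F).locallyIntegrable
      hg.continuous
  have e1 := (hcont.memLp_of_hasCompactSupport (p := 2) (μ := volume)
    ((hasCompactSupport_differenceKernel ε F).convolution _ hgc)).eLpNorm_eq_integral_rpow_norm
    (by norm_num) (by norm_num)
  have e2 := (hg.continuous.memLp_of_hasCompactSupport (p := 2) (μ := volume)
    hgc).eLpNorm_eq_integral_rpow_norm (by norm_num) (by norm_num)
  rw [e1, e2, ← ENNReal.ofReal_mul hm0]
  refine ENNReal.ofReal_le_ofReal ?_
  have h := integral_sq_differenceKernel_convolution_le (F := F) hr hpos hε hgc hg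
  simp only [ENNReal.toReal_ofNat, Real.rpow_ofNat, ← one_div, ← Real.sqrt_eq_rpow]
  refine (Real.sqrt_le_sqrt h).trans (le_of_eq ?_)
  rw [Real.sqrt_mul (by positivity), Real.sqrt_sq hm0]

/-- The partial sums are convolution operators with uniformly Hörmander kernels. -/
theorem isHormanderKernel_differenceKernel (hr : r < 1) (hpos : ∀ k, 0 < ε k)
    (hε : ∀ k, ε (k + 1) ≤ r * ε k) :
    IsHormanderKernel (differenceKernel ε F) (ENNReal.ofReal (4 / (1 - r) + 1) ^ 2)
      (ENNReal.ofReal (4 / (1 - r))) where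
  measurable := measurable_differenceKernel ε F
  integrable := integrable_differenceKernel ε F
  lintegral_sq_le g hgm hgi hgb := by
    obtain ⟨M, hM⟩ := hgb
    have hg2 : MemLp (fun x => (g x : ℂ)) 2 := by
      have h1 : MemLp g 2 := by
        rw [memLp_two_iff_integrable_sq hgm.aestronglyMeasurable]
        simp only [sq]
        exact hgi.mul_bdd hgm.aestronglyMeasurable (ae_of_all _ hM)
      exact h1.ofReal
    have h := eLpNorm_two_differenceKernel_convolution_le (F := F) hr hpos hε hg2
    have hconv : ∀ x, ‖(differenceKernel ε F ⋆[lsmul ℝ ℝ] fun x => (g x : ℂ)) x‖ₑ =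
        ‖(differenceKernel ε F ⋆[lsmul ℝ ℝ] g) x‖ₑ := fun x => by
      rw [convolution_lsmul, convolution_lsmul]
      simp only [Complex.real_smul, ← Complex.ofReal_mul, smul_eq_mul]
      rw [integral_complex_ofReal]
      simp [← ofReal_norm]
    have h' := ENNReal.rpow_le_rpow h (zero_le_two (α := ℝ))
    rw [ENNReal.mul_rpow_of_nonneg _ _ zero_le_two,
      eLpNorm_eq_lintegral_rpow_enorm_toReal (by norm_num) (by norm_num),
      eLpNorm_eq_lintegral_rpow_enorm_toReal (by norm_num) (by norm_num),
      ← ENNReal.rpow_mul, ← ENNReal.rpow_mul] at h'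
    simpa [hconv, ← ofReal_norm] using h'
  hormander h hh y hy := by
    obtain ⟨n, hn⟩ := F.exists_nat_subset_range
    -- Each difference contributes `2 c (k + 1) + 2 c k`, and `c` sums to at most `1 / (1 - r)`;
    -- hence `4 / (1 - r)`.
    set c : ℕ → ℝ := fun k => if h ≤ ε k then h / ε k else 0 with hc
    have hc0 : ∀ k, 0 ≤ c k := fun k => by
      have := hpos k
      simp only [hc]; split_ifs <;> positivity
    have hm : ∀ e, Measurable fun x => ‖boxKernel e (x - y) - boxKernel e x‖ₑ := fun e => by
      have := measurable_boxKernel e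
      fun_prop
    have hle : ∀ x, ‖differenceKernel ε F (x - y) - differenceKernel ε F x‖ₑ ≤
        ∑ k ∈ F, (‖boxKernel (ε (k + 1)) (x - y) - boxKernel (ε (k + 1)) x‖ₑ +
          ‖boxKernel (ε k) (x - y) - boxKernel (ε k) x‖ₑ) := fun x => by
      rw [differenceKernel, differenceKernel, ← Finset.sum_sub_distrib]
      refine (enorm_sum_le _ _).trans (Finset.sum_le_sum fun k _ => ?_)
      rw [sub_sub_sub_comm]
      exact enorm_sub_le
    calc _ ≤ ∫⁻ x in {x | 2 * h < |x|}, ∑ k ∈ F,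
          (‖boxKernel (ε (k + 1)) (x - y) - boxKernel (ε (k + 1)) x‖ₑ +
            ‖boxKernel (ε k) (x - y) - boxKernel (ε k) x‖ₑ) := lintegral_mono hle
      _ = ∑ k ∈ F, ((∫⁻ x in {x | 2 * h < |x|},
            ‖boxKernel (ε (k + 1)) (x - y) - boxKernel (ε (k + 1)) x‖ₑ) +
          ∫⁻ x in {x | 2 * h < |x|}, ‖boxKernel (ε k) (x - y) - boxKernel (ε k) x‖ₑ) := by
          have hm2 : ∀ k, Measurable fun x =>
              ‖boxKernel (ε (k + 1)) (x - y) - boxKernel (ε (k + 1)) x‖ₑ +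
                ‖boxKernel (ε k) (x - y) - boxKernel (ε k) x‖ₑ := fun k => (hm _).add (hm _)
          rw [lintegral_finsetSum _ fun k _ => hm2 k]
          exact Finset.sum_congr rfl fun k _ => lintegral_add_left (hm _) _
      _ ≤ ∑ k ∈ F, (ENNReal.ofReal (2 * c (k + 1)) + ENNReal.ofReal (2 * c k)) := by
          gcongr <;> exact setLIntegral_boxKernel_sub_le (hpos _) hy
      _ = ENNReal.ofReal (∑ k ∈ F, (2 * c (k + 1) + 2 * c k)) := by
          rw [ENNReal.ofReal_sum_of_nonneg fun k _ => by
            have := hc0 (k + 1); have := hc0 k; positivity]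
          exact Finset.sum_congr rfl fun k _ => (ENNReal.ofReal_add
            (by have := hc0 (k + 1); positivity) (by have := hc0 k; positivity)).symm
      _ ≤ _ := by
          refine ENNReal.ofReal_le_ofReal ?_
          have h1 : ∑ k ∈ F, (2 * c (k + 1) + 2 * c k) ≤
              ∑ k ∈ Finset.range n, (2 * c (k + 1) + 2 * c k) :=
            Finset.sum_le_sum_of_subset_of_nonneg hn fun k _ _ => by
              have := hc0 (k + 1); have := hc0 k; positivity
          have hsum : ∑ k ∈ Finset.range n, (2 * c (k + 1) + 2 * c k) =
              2 * ∑ k ∈ Finset.range n, c (k + 1) + 2 * ∑ k ∈ Finset.range n, c k := by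
            rw [Finset.sum_add_distrib, ← Finset.mul_sum, ← Finset.mul_sum]
          have h2 := sum_large_scales_le hr hpos hε hh (n + 1)
          rw [Finset.sum_range_succ'] at h2
          have h3 := sum_large_scales_le hr hpos hε hh n
          have h4 := hc0 0
          have h5 : 4 / (1 - r) = 4 * (1 / (1 - r)) := by ring
          simp only [hc] at h1 h4 hsum ⊢
          linarith

/-- Uniform `L^p` bounds for the finite partial sums. -/
theorem exists_eLpNorm_sum_lineD_sub_le (hr : r < 1) (hpos : ∀ k, 0 < ε k)
    (hε : ∀ k, ε (k + 1) ≤ r * ε k) {p : ℝ≥0∞} (hp : 1 < p) (hpt : p < ∞) :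
    ∃ C : ℝ≥0∞, C ≠ ∞ ∧ ∀ (F : Finset ℕ) (f : ℝ → ℂ), MemLp f p →
      eLpNorm (fun x => ∑ k ∈ F, (lineD (ε (k + 1)) f x - lineD (ε k) f x)) p volume ≤
        C * eLpNorm f p volume := by
  obtain ⟨C, hC, h⟩ := exists_eLpNorm_convolution_le
    (A := ENNReal.ofReal (4 / (1 - r) + 1) ^ 2) (B := ENNReal.ofReal (4 / (1 - r)))
    (by finiteness) (by finiteness) hp hpt
  refine ⟨C, hC, fun F f hf => ?_⟩
  obtain ⟨M, hM⟩ := exists_abs_differenceKernel_le ε F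
  rw [← differenceKernel_convolution hpos (hf.locallyIntegrable hp.le)]
  exact eLpNorm_convolution_le_of_contDiff hp.le hpt.ne hC (measurable_differenceKernel ε F) hM
    (hasCompactSupport_differenceKernel ε F) (integrable_differenceKernel ε F)
    (fun g hgc hg => h _ (isHormanderKernel_differenceKernel hr hpos hε)
      (differenceKernel_neg ε F) (hasCompactSupport_differenceKernel ε F) g hg.continuous hgc) hf

end DifferenceKernel

/-! ### Smallness of late partial sums on the line. -/

theorem memLp_lineD {e : ℝ} (he : 0 < e) {p : ℝ≥0∞} (hp : 1 ≤ p) (hpt : p ≠ ∞) {f : ℝ → ℂ}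
    (hf : MemLp f p) : MemLp (lineD e f) p := by
  rw [lineD_eq_convolution he]
  exact ⟨aestronglyMeasurable_convolution (measurable_boxKernel e).aestronglyMeasurable
    hf.aestronglyMeasurable, (eLpNorm_convolution_le hp hpt (integrable_boxKernel e)
    (measurable_boxKernel e) hf.aestronglyMeasurable).trans_lt
    (ENNReal.mul_lt_top (integrable_boxKernel e).2 hf.2)⟩

theorem lineD_sub {e : ℝ} (he : 0 < e) {f g : ℝ → ℂ} (hf : LocallyIntegrable f)
    (hg : LocallyIntegrable g) (x : ℝ) : lineD e (f - g) x = lineD e f x - lineD e g x := by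
  simp only [lineD_eq_convolution he, convolution_lsmul, Pi.sub_apply, smul_sub]
  exact integral_sub (integrable_lineD_integrand hf e x) (integrable_lineD_integrand hg e x)

theorem norm_lineD_sub_le {e : ℝ} (he : 0 < e) {g : ℝ → ℂ} {L : ℝ≥0} (hg : LipschitzWith L g)
    (x : ℝ) : ‖lineD e g x - g x‖ ≤ L * e := by
  have heC : (e : ℂ) ≠ 0 := by exact_mod_cast he.ne'
  have hconst : g x = ((1 / (2 * e) : ℝ) : ℂ) * ∫ _ in (-e)..e, g x := by
    rw [intervalIntegral.integral_const, Complex.real_smul]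
    push_cast
    field_simp
    ring
  have hgc := hg.continuous
  rw [hconst, lineD, ← mul_sub, ← intervalIntegral.integral_sub
    ((by fun_prop : Continuous fun y => g (x - y)).intervalIntegrable _ _)
    (by simp), norm_mul]
  have h : ‖∫ y in (-e)..e, (g (x - y) - g x)‖ ≤ L * e * |e - -e| := by
    refine intervalIntegral.norm_integral_le_of_norm_le_const fun y hy => ?_
    rw [Set.uIoc_of_le (by linarith)] at hy
    refine (hg.norm_sub_le _ _).trans ?_
    gcongr
    rw [sub_sub_cancel_left, norm_neg, Real.norm_eq_abs]
    exact abs_le.2 ⟨hy.1.le, hy.2⟩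
  rw [sub_neg_eq_add, abs_of_pos (by linarith : 0 < e + e)] at h
  calc _ ≤ ‖((1 / (2 * e) : ℝ) : ℂ)‖ * (L * e * (e + e)) := by gcongr
    _ = _ := by
      rw [Complex.norm_real, Real.norm_of_nonneg (by positivity)]
      field_simp
      ring

/-- For test functions the averages converge in `L^p` at a linear rate. -/
theorem exists_eLpNorm_lineD_sub_le {p : ℝ≥0∞} {g : ℝ → ℂ} (hgc : HasCompactSupport g)
    (hg : ContDiff ℝ (⊤ : ℕ∞) g) :
    ∃ W : ℝ≥0∞, W ≠ ∞ ∧ ∀ e, 0 < e → e ≤ 1 →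
      eLpNorm (lineD e g - g) p volume ≤ W * ENNReal.ofReal e := by
  obtain ⟨L, hL⟩ := hg.lipschitzWith_of_hasCompactSupport hgc (by simp)
  obtain ⟨R, hR⟩ := hgc.isCompact.isBounded.subset_closedBall 0
  have hR' : ∀ t, R < |t| → g t = 0 := fun t ht => by
    by_contra h
    have := hR (subset_tsupport _ (Function.mem_support.2 h))
    simp at this
    linarith
  -- For `e ≤ 1` both `g` and its average vanish outside this fixed ball.
  set V := Metric.closedBall (0 : ℝ) (R + 1) with hV
  have hVt : volume V ≠ ∞ := measure_closedBall_lt_top.ne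
  refine ⟨L * volume V ^ (1 / p.toReal), by finiteness, fun e he he1 => ?_⟩
  have hpt : ∀ x, ‖(lineD e g - g) x‖ ≤ ‖V.indicator (fun _ => (L * e : ℝ)) x‖ := by
    intro x
    by_cases hx : x ∈ V
    · rw [Set.indicator_of_mem hx, Real.norm_of_nonneg (by positivity)]
      exact norm_lineD_sub_le he hL x
    · rw [Set.indicator_of_notMem hx, norm_zero, Pi.sub_apply]
      simp only [hV, Metric.mem_closedBall, Real.dist_eq, sub_zero, not_le] at hx
      have h0 : ∫ y in (-e)..e, g (x - y) = ∫ y in (-e)..e, (0 : ℂ) := by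
        refine intervalIntegral.integral_congr fun y hy => hR' _ ?_
        rw [Set.uIcc_of_le (by linarith)] at hy
        have := abs_le.2 hy
        have := abs_sub_abs_le_abs_sub x y
        linarith
      rw [lineD, h0, hR' x (by linarith)]
      simp
  refine (eLpNorm_mono hpt).trans ((eLpNorm_indicator_const_le _ _).trans (le_of_eq ?_))
  rw [Real.enorm_of_nonneg (by positivity), ENNReal.ofReal_mul (by positivity),
    ENNReal.ofReal_coe_nnreal]
  ring

section Convergence

variable {r : ℝ} {ε : ℕ → ℝ}

theorem summable_of_lacunary (hr : r < 1) (hpos : ∀ k, 0 < ε k)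
    (hε : ∀ k, ε (k + 1) ≤ r * ε k) : Summable ε := by
  have hr0 := lacunary_ratio_pos hpos hε
  have h : ∀ k, ε k ≤ r ^ k * ε 0 := fun k => by
    induction k with
    | zero => simp
    | succ k ih =>
      calc ε (k + 1) ≤ r * ε k := hε k
        _ ≤ r * (r ^ k * ε 0) := by gcongr
        _ = _ := by ring
  exact .of_nonneg_of_le (fun k => (hpos k).le) h
    ((summable_geometric_of_lt_one hr0.le hr).mul_right _)

/-- Finite partial sums over late indices are small in `L^p`. -/
theorem exists_forall_eLpNorm_sum_lineD_le (hr : r < 1) (hpos : ∀ k, 0 < ε k)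
    (hε : ∀ k, ε (k + 1) ≤ r * ε k) {p : ℝ≥0∞} (hp : 1 < p) (hpt : p < ∞) {f : ℝ → ℂ}
    (hf : MemLp f p) {η : ℝ} (hη : 0 < η) :
    ∃ N : ℕ, ∀ F : Finset ℕ, (∀ k ∈ F, N ≤ k) →
      eLpNorm (fun x => ∑ k ∈ F, (lineD (ε (k + 1)) f x - lineD (ε k) f x)) p volume ≤
        ENNReal.ofReal η := by
  obtain ⟨C, hC, hbound⟩ := exists_eLpNorm_sum_lineD_sub_le hr hpos hε hp hpt
  -- The tolerance makes `C * ‖f - g‖ ≤ η / 2`; adding `1` covers `C = 0`.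
  obtain ⟨g, hgc, hgs, hfg⟩ := hf.exist_eLpNorm_sub_le hpt.ne hp.le
    (ε := η / (2 * (C.toReal + 1))) (by positivity)
  have hg : MemLp g p := hgs.continuous.memLp_of_hasCompactSupport hgc
  obtain ⟨W, hW, hlin⟩ := exists_eLpNorm_lineD_sub_le (p := p) hgc hgs
  have hr0 := lacunary_ratio_pos hpos hε
  have hmono : ∀ n, ε (n + 1) ≤ ε n := fun n => (hε n).trans (by nlinarith [hpos n])
  have hsum := summable_of_lacunary hr hpos hε
  -- A term at index `k` costs at most `W * 2 ε k` on the test function, so this tail of `∑ ε k`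
  -- accounts for the other `η / 2`.
  obtain ⟨s, hs⟩ := summable_iff_vanishing_norm.1 hsum (η / (4 * (W.toReal + 1))) (by positivity)
  obtain ⟨N₁, hN₁⟩ := s.exists_nat_subset_range
  obtain ⟨N₂, hN₂⟩ := eventually_atTop.1
    ((hsum.tendsto_atTop_zero.eventually (Iic_mem_nhds zero_lt_one)))
  refine ⟨max N₁ N₂, fun F hF => ?_⟩
  have hFsum : ∑ k ∈ F, ε k ≤ η / (4 * (W.toReal + 1)) := by
    refine (le_abs_self _).trans (hs F (Finset.disjoint_left.2 fun k hk hks => ?_)).le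
    have := Finset.mem_range.1 (hN₁ hks)
    have := (le_max_left _ _).trans (hF k hk)
    omega
  have hF1 : ∀ k ∈ F, ε k ≤ 1 := fun k hk => hN₂ k ((le_max_right _ _).trans (hF k hk))
  have hsplit : (fun x => ∑ k ∈ F, (lineD (ε (k + 1)) f x - lineD (ε k) f x)) =
      (∑ k ∈ F, ((lineD (ε (k + 1)) g - g) - (lineD (ε k) g - g))) +
      fun x => ∑ k ∈ F, (lineD (ε (k + 1)) (f - g) x - lineD (ε k) (f - g) x) := by
    ext x
    simp only [Pi.add_apply, Finset.sum_apply, Pi.sub_apply, ← Finset.sum_add_distrib,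
      lineD_sub (hpos _) (hf.locallyIntegrable hp.le) (hg.locallyIntegrable hp.le)]
    exact Finset.sum_congr rfl fun k _ => by ring
  have hD : ∀ k (u : ℝ → ℂ), MemLp u p → AEStronglyMeasurable (lineD (ε k) u) := fun k u hu =>
    (memLp_lineD (hpos k) hp.le hpt.ne hu).aestronglyMeasurable
  have hDg : ∀ k, AEStronglyMeasurable (lineD (ε k) g - g) := fun k =>
    (hD k g hg).sub hg.aestronglyMeasurable
  have hfgm := hf.sub hg
  have hmeas2 : AEStronglyMeasurable
      (fun x => ∑ k ∈ F, (lineD (ε (k + 1)) (f - g) x - lineD (ε k) (f - g) x)) :=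
    Finset.aestronglyMeasurable_fun_sum _ fun k _ => (hD _ _ hfgm).sub (hD _ _ hfgm)
  rw [hsplit]
  refine (eLpNorm_add_le (Finset.aestronglyMeasurable_sum _ fun k _ => (hDg _).sub (hDg _))
    hmeas2 hp.le).trans ?_
  have e1 : eLpNorm (∑ k ∈ F, ((lineD (ε (k + 1)) g - g) - (lineD (ε k) g - g))) p volume ≤
      ENNReal.ofReal (η / 2) := by
    calc _ ≤ ∑ k ∈ F, eLpNorm ((lineD (ε (k + 1)) g - g) - (lineD (ε k) g - g)) p volume :=
          eLpNorm_sum_le (fun k _ => (hDg _).sub (hDg _)) hp.le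
      _ ≤ ∑ k ∈ F, W * ENNReal.ofReal (2 * ε k) := by
          refine Finset.sum_le_sum fun k hk => (eLpNorm_sub_le (hDg _) (hDg _) hp.le).trans ?_
          have h1 := hlin (ε (k + 1)) (hpos _) ((hmono k).trans (hF1 k hk))
          have h2 := hlin (ε k) (hpos _) (hF1 k hk)
          refine (add_le_add h1 h2).trans ?_
          rw [← mul_add, ← ENNReal.ofReal_add (hpos _).le (hpos _).le]
          gcongr
          linarith [hmono k]
      _ = ENNReal.ofReal (W.toReal * (2 * ∑ k ∈ F, ε k)) := by
          rw [← Finset.mul_sum, ← ENNReal.ofReal_sum_of_nonneg fun k _ => by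
            have := hpos k; positivity, ← Finset.mul_sum,
            ENNReal.ofReal_mul W.toReal_nonneg, ENNReal.ofReal_toReal hW]
      _ ≤ _ := by
          refine ENNReal.ofReal_le_ofReal ?_
          have h1 : W.toReal * (2 * ∑ k ∈ F, ε k) ≤
              (W.toReal + 1) * (2 * (η / (4 * (W.toReal + 1)))) := by
            gcongr
            · exact mul_nonneg zero_le_two (Finset.sum_nonneg fun k _ => (hpos k).le)
            · linarith
          refine h1.trans (le_of_eq ?_)
          field_simp
          norm_num
  have e2 : C * eLpNorm (f - g) p volume ≤ ENNReal.ofReal (η / 2) := by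
    calc _ ≤ C * ENNReal.ofReal (η / (2 * (C.toReal + 1))) := by gcongr
      _ = ENNReal.ofReal (C.toReal * (η / (2 * (C.toReal + 1)))) := by
          rw [ENNReal.ofReal_mul (by positivity), ENNReal.ofReal_toReal hC]
      _ ≤ _ := by
          refine ENNReal.ofReal_le_ofReal ?_
          rw [mul_div_assoc', div_le_div_iff₀ (by positivity) (by positivity)]
          nlinarith [C.toReal_nonneg]
  refine (add_le_add e1 ((hbound F _ hfgm).trans e2)).trans (le_of_eq ?_)
  rw [← ENNReal.ofReal_add (by positivity) (by positivity), add_halves]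

end Convergence

/-! ### From finite sums to unconditional convergence. -/

/-- `Summable` is convergence along the net of finite index sets, hence invariant under reindexing.
-/
theorem unconditionallyConvergent_of_summable {E : Type*} [NormedAddCommGroup E] {u : ℕ → E}
    (hu : Summable u) : UnconditionallyConvergent u := fun σ =>
  ⟨_, ((Equiv.summable_iff σ).2 hu).hasSum.tendsto_sum_nat⟩

/-- A Cauchy criterion for unconditional convergence of a telescoping series in `L^p`. -/
theorem unconditionallyConvergent_toLp_sub {α : Type*} [MeasurableSpace α] {μ : Measure α}
    {p : ℝ≥0∞} [Fact (1 ≤ p)] {d : ℕ → α → ℂ} (hd : ∀ k, MemLp (d k) p μ)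
    (h : ∀ η : ℝ, 0 < η → ∃ N : ℕ, ∀ F : Finset ℕ, (∀ k ∈ F, N ≤ k) →
      eLpNorm (fun x => ∑ k ∈ F, (d (k + 1) x - d k x)) p μ ≤ ENNReal.ofReal η) :
    UnconditionallyConvergent fun k => (hd (k + 1)).toLp (d (k + 1)) - (hd k).toLp (d k) := by
  refine unconditionallyConvergent_of_summable (summable_iff_vanishing_norm.2 fun η hη => ?_)
  obtain ⟨N, hN⟩ := h (η / 2) (half_pos hη)
  refine ⟨Finset.range N, fun F hF => ?_⟩
  have hae : ⇑(∑ k ∈ F, ((hd (k + 1)).toLp (d (k + 1)) - (hd k).toLp (d k))) =ᵐ[μ]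
      fun x => ∑ k ∈ F, (d (k + 1) x - d k x) := by
    have hk : ∀ᵐ x ∂μ, ∀ k, (hd k).toLp (d k) x = d k x :=
      ae_all_iff.2 fun k => (hd k).coeFn_toLp
    have hsub : ∀ᵐ x ∂μ, ∀ k, ((hd (k + 1)).toLp (d (k + 1)) - (hd k).toLp (d k) : Lp ℂ p μ) x =
        (hd (k + 1)).toLp (d (k + 1)) x - (hd k).toLp (d k) x :=
      ae_all_iff.2 fun k => Lp.coeFn_sub _ _
    filter_upwards [Lp.coeFn_fun_finsetSum F fun k =>
      (hd (k + 1)).toLp (d (k + 1)) - (hd k).toLp (d k), hk, hsub] with x h1 h2 h3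
    rw [h1]
    exact Finset.sum_congr rfl fun k _ => by rw [h3, h2, h2]
  rw [Lp.norm_def, eLpNorm_congr_ae hae]
  have hle := hN F fun k hk => by
    by_contra hlt
    exact Finset.disjoint_left.1 hF hk (Finset.mem_range.2 (not_le.1 hlt))
  calc _ ≤ (ENNReal.ofReal (η / 2)).toReal := ENNReal.toReal_mono ENNReal.ofReal_ne_top hle
    _ = η / 2 := ENNReal.toReal_ofReal (by positivity)
    _ < η := half_lt_self hη

/-! ### Transference to the circle. -/

section Torus

/-- The representative in `(0, 2π]` of a point of the circle. -/
noncomputable def torusRep (x : AddCircle (2 * π)) : ℝ := AddCircle.equivIoc (2 * π) 0 x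

theorem torusRep_mem (x : AddCircle (2 * π)) : torusRep x ∈ Set.Ioc 0 (2 * π) := by
  have h : torusRep x ∈ Set.Ioc 0 (0 + 2 * π) := (AddCircle.equivIoc (2 * π) 0 x).2
  rwa [zero_add] at h

theorem coe_torusRep (x : AddCircle (2 * π)) : (torusRep x : AddCircle (2 * π)) = x :=
  (AddCircle.equivIoc (2 * π) 0).symm_apply_apply x

theorem measurePreserving_torusRep :
    MeasurePreserving torusRep volume (volume.restrict (Set.Ioc 0 (2 * π))) := by
  have h : MeasurePreserving torusRep volume (volume.restrict (Set.Ioc 0 (0 + 2 * π))) :=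
    (measurePreserving_subtype_coe measurableSet_Ioc).comp
      (AddCircle.measurePreserving_equivIoc (2 * π) (a := 0))
  rwa [zero_add] at h

/-- The periodic lift of `f`, cut off to `(-2πn, 2π(n+1)]`. -/
noncomputable def truncatedLift (n : ℕ) (f : AddCircle (2 * π) → ℂ) : ℝ → ℂ :=
  (Set.Ioc (-(n * (2 * π))) (-(n * (2 * π)) + ((2 * n + 1 : ℕ) : ℝ) * (2 * π))).indicator
    fun x => f x

/-- The cut-off lift is a finite sum of one-period pieces, each a measure-preserving copy of `f`. -/
theorem memLp_truncatedLift (n : ℕ) {p : ℝ≥0∞} {f : AddCircle (2 * π) → ℂ} (hf : MemLp f p) :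
    MemLp (truncatedLift n f) p := by
  have h : ∀ (a : ℝ) (m : ℕ), MemLp ((Set.Ioc a (a + m * (2 * π))).indicator
      fun x : ℝ => f x) p := fun a m => by
    induction m with
    | zero => simp
    | succ m ih =>
      have hpi := Real.two_pi_pos
      have hstep : MemLp ((Set.Ioc (a + m * (2 * π)) (a + m * (2 * π) + 2 * π)).indicator
          fun x : ℝ => f x) p := by
        rw [memLp_indicator_iff_restrict measurableSet_Ioc]
        exact hf.comp_measurePreserving (AddCircle.measurePreserving_mk (2 * π) _)
      have hun : Set.Ioc a (a + ((m + 1 : ℕ) : ℝ) * (2 * π)) =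
          Set.Ioc a (a + m * (2 * π)) ∪
            Set.Ioc (a + m * (2 * π)) (a + m * (2 * π) + 2 * π) := by
        rw [Set.Ioc_union_Ioc_eq_Ioc (by have : 0 ≤ (m : ℝ) * (2 * π) := by positivity
                                         linarith) (by linarith)]
        congr 1
        push_cast
        ring
      rw [hun, Set.indicator_union_of_disjoint]
      · exact ih.add hstep
      · exact Set.disjoint_left.2 fun x h1 h2 => absurd h1.2 (not_le.2 h2.1)
  exact h _ _

/-- Moving a point of `(0, 2π]` by at most `n` periods stays inside the truncation window, so the
cut-off is not seen. -/
theorem torusD_eq_comp {e : ℝ} (he : 0 < e) {n : ℕ} (hn : e ≤ n * (2 * π))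
    (f : AddCircle (2 * π) → ℂ) : torusD e f = lineD e (truncatedLift n f) ∘ torusRep := by
  ext x
  have hx := torusRep_mem x
  rw [Function.comp_apply, torusD, lineD]
  congr 1
  refine intervalIntegral.integral_congr fun y hy => ?_
  rw [Set.uIcc_of_le (by linarith)] at hy
  have hmem : torusRep x - y ∈
      Set.Ioc (-(n * (2 * π))) (-(n * (2 * π)) + ((2 * n + 1 : ℕ) : ℝ) * (2 * π)) := by
    push_cast
    constructor <;> linarith [hx.1, hx.2, hy.1, hy.2]
  simp only [truncatedLift, Set.indicator_of_mem hmem, AddCircle.coe_sub, coe_torusRep]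

theorem memLp_torusD {e : ℝ} (he : 0 < e) {p : ℝ≥0∞} (hp : 1 ≤ p) (hpt : p ≠ ∞)
    {f : AddCircle (2 * π) → ℂ} (hf : MemLp f p) : MemLp (torusD e f) p := by
  -- A long average may wrap around the circle many times, so the truncation must depend on `e`.
  obtain ⟨n, hn⟩ := exists_nat_ge (e / (2 * π))
  rw [torusD_eq_comp he ((div_le_iff₀ Real.two_pi_pos).1 hn)]
  exact ((memLp_lineD he hp hpt (memLp_truncatedLift n hf)).restrict _).comp_measurePreserving
    measurePreserving_torusRep

variable {r : ℝ} {ε : ℕ → ℝ}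

theorem exists_forall_eLpNorm_sum_torusD_le (hr : r < 1) (hpos : ∀ k, 0 < ε k)
    (hε : ∀ k, ε (k + 1) ≤ r * ε k) {p : ℝ≥0∞} (hp : 1 < p) (hpt : p < ∞)
    {f : AddCircle (2 * π) → ℂ} (hf : MemLp f p) {η : ℝ} (hη : 0 < η) :
    ∃ N : ℕ, ∀ F : Finset ℕ, (∀ k ∈ F, N ≤ k) →
      eLpNorm (fun x => ∑ k ∈ F, (torusD (ε (k + 1)) f x - torusD (ε k) f x)) p volume ≤
        ENNReal.ofReal η := by
  have hg := memLp_truncatedLift 1 hf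
  obtain ⟨N₁, hN₁⟩ := exists_forall_eLpNorm_sum_lineD_le hr hpos hε hp hpt hg hη
  -- From here on `ε k ≤ 2π`, so the single truncation `n = 1` serves all late terms.
  obtain ⟨N₂, hN₂⟩ := eventually_atTop.1 ((summable_of_lacunary hr hpos
    hε).tendsto_atTop_zero.eventually (Iic_mem_nhds Real.two_pi_pos))
  refine ⟨max N₁ N₂, fun F hF => ?_⟩
  have heq : (fun x => ∑ k ∈ F, (torusD (ε (k + 1)) f x - torusD (ε k) f x)) =
      (fun x => ∑ k ∈ F, (lineD (ε (k + 1)) (truncatedLift 1 f) x -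
        lineD (ε k) (truncatedLift 1 f) x)) ∘ torusRep := by
    ext x
    refine Finset.sum_congr rfl fun k hk => ?_
    have hk2 := (le_max_right _ _).trans (hF k hk)
    have h : ∀ j, N₂ ≤ j → torusD (ε j) f x = lineD (ε j) (truncatedLift 1 f) (torusRep x) :=
      fun j hj => by
        rw [torusD_eq_comp (hpos j) (n := 1) (by simpa using hN₂ j hj)]
        rfl
    rw [h k hk2, h (k + 1) (hk2.trans k.le_succ)]
  have hm : AEStronglyMeasurable (fun x => ∑ k ∈ F, (lineD (ε (k + 1)) (truncatedLift 1 f) x -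
      lineD (ε k) (truncatedLift 1 f) x)) :=
    Finset.aestronglyMeasurable_fun_sum _ fun k _ =>
      (memLp_lineD (hpos _) hp.le hpt.ne hg).aestronglyMeasurable.sub
        (memLp_lineD (hpos _) hp.le hpt.ne hg).aestronglyMeasurable
  rw [heq, eLpNorm_comp_measurePreserving hm.restrict measurePreserving_torusRep]
  exact (eLpNorm_mono_measure _ Measure.restrict_le_self).trans
    (hN₁ F fun k hk => (le_max_left _ _).trans (hF k hk))

end Torus

end

theorem theorem6p1 (r : ℝ) (hr : r < 1) (ε : ℕ → ℝ) (hpos : ∀ k, 0 < ε k)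
    (hε : ∀ k, ε (k + 1) ≤ r * ε k)
    (p : ℝ≥0∞) [Fact (1 ≤ p)] (hp : 1 < p) (hp' : p < ∞) :
    (∀ f : ℝ → ℂ, MemLp f p volume →
      ∃ h : ∀ k, MemLp (lineD (ε k) f) p volume,
        UnconditionallyConvergent
          (fun k => (h (k + 1)).toLp (lineD (ε (k + 1)) f) - (h k).toLp (lineD (ε k) f))) ∧
    (∀ f : AddCircle (2 * π) → ℂ, MemLp f p volume →
      ∃ h : ∀ k, MemLp (torusD (ε k) f) p volume,
        UnconditionallyConvergent
          (fun k => (h (k + 1)).toLp (torusD (ε (k + 1)) f) - (h k).toLp (torusD (ε k) f))) :=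
  ⟨fun _ hf => ⟨fun k => memLp_lineD (hpos k) hp.le hp'.ne hf,
    unconditionallyConvergent_toLp_sub (d := fun k => lineD (ε k) _) _ fun _ hη =>
      exists_forall_eLpNorm_sum_lineD_le hr hpos hε hp hp' hf hη⟩,
  fun _ hf => ⟨fun k => memLp_torusD (hpos k) hp.le hp'.ne hf,
    unconditionallyConvergent_toLp_sub (d := fun k => torusD (ε k) _) _ fun _ hη =>
      exists_forall_eLpNorm_sum_torusD_le hr hpos hε hp hp' hf hη⟩⟩
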